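/- **Proposition 2.5 (conditional mean diagonal overlap at finite $N$).** Let $N\ge 1$ be an integer and let $dA(z)=d^2z/\pi$. For a weight $\omega:\mathbb{C}\to\mathbb{R}_{\ge0}$ and $n\ge 0$ put $$Z_n[\omega]=\int_{\mathbb{C}^n}\prod_{1\le j<l\le n}|z_j-z_l|^2|z_j-\overline z_l|^2\prod_{j=1}^n|z_j-\overline z_j|^2\,\omega(z_j)\,dA(z_j),\qquad Z_0[\omega]=1 .$$ For $x\in\mathbb{C}$ let $$\omega^{(\mathrm g)}(z)=e^{-2|z|^2},\qquad \omega^{(\mathrm{over})}(z|x)=|z-\overline x|^2\,(1+|z-x|^2)\,e^{-2|z|^2},$$ and write $Z_n^{(\mathrm g)}=Z_n[\omega^{(\mathrm g)}]$, $Z_n^{(\mathrm{over})}(x)=Z_n[\omega^{(\mathrm{over})}(\cdot|x)]$. Let $$\mathbf R_{N,1}^{(\mathrm g)}(z_1)=\frac{N}{Z_N^{(\mathrm g)}}\int_{\mathbb{C}^{N-1}}\prod_{1\le j<l\le N}|z_j-z_l|^2|z_j-\overline z_l|^2\prod_{j=1}^N|z_j-\overline z_j|^2\omega^{(\mathrm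 g)}(z_j)\prod_{j=2}^N dA(z_j)$$ be the one-point function of the quaternionic (symplectic) Ginibre ensemble, and let $$D_{1,1}^{(N,1)}(z_1)=\frac{N}{Z_N^{(\mathrm g)}}|z_1-\overline z_1|^2e^{-2|z_1|^2}\int_{\mathbb{C}^{N-1}}\prod_{2\le j<l\le N}|z_j-z_l|^2|z_j-\overline z_l|^2\prod_{l=2}^N|z_l-\overline z_l|^2\,\omega^{(\mathrm{over})}(z_l|z_1)\,dA(z_l)$$ be its mean diagonal overlap. Let further $$\boldsymbol\varkappa_N^{(\mathrm g)}(z,w)=\sqrt2\sum_{k=0}^{N-1}\sum_{\ell=0}^{k}\left(\frac{(\sqrt2z)^{2k+1}}{(2k+1)!!}\frac{(\sqrt2w)^{2\ell}}{(2\ell)!!}-\frac{(\sqrt2w)^{2k+1}}{(2k+1)!!}\frac{(\sqrt2z)^{2\ell}}{(2\ell)!!}\right),\qquad \widehat{\boldsymbol\varkappa}_N^{(\mathrm g)}(z,w)=e^{-2zw}\boldsymbol\varkappa_N^{(\mathrm g)}(z,w).$$ Then $Z_N^{(\mathrm g)}>0$, $Z_{N-1}^{(\mathrm{over})}(a)>0$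 for every $a\in\mathbb{C}$, and $\mathbf R_{N,1}^{(\mathrm g)}(a)>0$ for every $a\in\mathbb{C}\setminus\mathbb{R}$. Define the conditional mean diagonal overlap by $$\widehat D_{1,1}^{(N,1)}(a)=\frac{D_{1,1}^{(N,1)}(a)}{\mathbf R_{N,1}^{(\mathrm g)}(a)}\quad(a\in\mathbb{C}\setminus\mathbb{R}),\qquad \widehat D_{1,1}^{(N,1)}(a)=\lim_{z\to a,\ z\notin\mathbb{R}}\frac{D_{1,1}^{(N,1)}(z)}{\mathbf R_{N,1}^{(\mathrm g)}(z)}\quad(a\in\mathbb{R});$$ the limit exists for every $a\in\mathbb{R}$. The denominators in the following formula do not vanish, and $$\widehat D_{1,1}^{(N,1)}(a)=\frac{N\,Z_{N-1}^{(\mathrm{over})}(a)}{Z_N^{(\mathrm g)}}\begin{cases}\dfrac{a-\overline a}{\boldsymbol\varkappa_N^{(\mathrm g)}(a,\overline a)}&\text{if }a\in\mathbb{C}\setminus\mathbb{R},\\[3mm]\dfrac{e^{-2a^2}}{\partial_x\widehat{\boldsymbol\varkappa}_N^{(\mathrm g)}(x,a)\big|_{x=a}}&\text{if }a\in\mathbb{R}.\end{cases}$$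 -/

import Mathlib

open MeasureTheory Filter Topology
open scoped ComplexConjugate Nat

noncomputable section

namespace GinSE

/-- The area measure `dA(z) = d²z / π` on the complex plane. -/
def areaMeasure : Measure ℂ := (Real.toNNReal Real.pi)⁻¹ • volume

/-- The product measure `dA(z_1) ⋯ dA(z_n)` on `ℂⁿ`. -/
def areaMeasurePi (n : ℕ) : Measure (Fin n → ℂ) := Measure.pi fun _ => areaMeasure

/-- The unnormalised density of a planar symplectic ensemble of `n` points with weight `ω`:
`∏_{j<l} |z_j - z_l|² |z_j - conj z_l|² ∏_j |z_j - conj z_j|² ω(z_j)`. -/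
def symplecticWeight (ω : ℂ → ℝ) {n : ℕ} (z : Fin n → ℂ) : ℝ :=
  (∏ j : Fin n, ∏ l ∈ Finset.Ioi j, ‖z j - z l‖ ^ 2 * ‖z j - conj (z l)‖ ^ 2) *
    ∏ j : Fin n, ‖z j - conj (z j)‖ ^ 2 * ω (z j)

/-- The partition function `Z_n` of the weight `ω`. -/
def partitionFunction (ω : ℂ → ℝ) (n : ℕ) : ℝ :=
  ∫ z : Fin n → ℂ, symplecticWeight ω z ∂(areaMeasurePi n)

/-- The joint density `P_n` of the points, with respect to `dA(z_1) ⋯ dA(z_n)`. -/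
def jointDensity (ω : ℂ → ℝ) {n : ℕ} (z : Fin n → ℂ) : ℝ :=
  1 / partitionFunction ω n * symplecticWeight ω z

/-- The configuration `(z_1, …, z_k, w_1, …, w_{N-k})`. -/
def joinConfig {N k : ℕ} (z : Fin k → ℂ) (w : Fin (N - k) → ℂ) : Fin N → ℂ := fun j =>
  if h : (j : ℕ) < k then z ⟨j, h⟩ else w ⟨(j : ℕ) - k, by omega⟩

/-- The `k`-point correlation function `R_{N,k}` of the weight `ω`, for `k ≤ N`. -/
def correlation (ω : ℂ → ℝ) (N k : ℕ) (z : Fin k → ℂ) : ℝ :=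
  (N ! : ℝ) / ((N - k)! : ℝ) *
    ∫ w : Fin (N - k) → ℂ, jointDensity ω (joinConfig (N := N) z w) ∂(areaMeasurePi (N - k))

/-- The Gaussian weight `e^{-2|z|²}`. -/
def gaussianWeight (z : ℂ) : ℝ := Real.exp (-2 * ‖z‖ ^ 2)

/-- The overlap weight
`(z - conj x)(conj z - x)(1 + (z - x)(conj z - conj x)) e^{-2 z conj z}` at the point `x`. -/
def overlapWeight (x z : ℂ) : ℝ :=
  ‖z - conj x‖ ^ 2 * (1 + ‖z - x‖ ^ 2) * Real.exp (-2 * ‖z‖ ^ 2)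

/-- The mean diagonal overlap `D_{1,1}^{(N,k)}(z_1, …, z_k)`, for `1 ≤ k ≤ N`. With
`Z = (z_1, …, z_N)`, the two products run over `2 ≤ j < l ≤ N` and over `2 ≤ l ≤ N`
(the index `0 : Fin N` stands for the first point). -/
def meanDiagonalOverlap (N k : ℕ) [NeZero k] (z : Fin k → ℂ) : ℝ :=
  (N ! : ℝ) / ((N - k)! : ℝ) * (1 / partitionFunction gaussianWeight N) *
    (‖z 0 - conj (z 0)‖ ^ 2 * Real.exp (-2 * ‖z 0‖ ^ 2)) *
    ∫ w : Fin (N - k) → ℂ,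
      (let Z : Fin N → ℂ := joinConfig z w
       (∏ j ∈ Finset.univ.filter (fun j : Fin N => 0 < (j : ℕ)), ∏ l ∈ Finset.Ioi j,
          ‖Z j - Z l‖ ^ 2 * ‖Z j - conj (Z l)‖ ^ 2) *
        ∏ l ∈ Finset.univ.filter (fun l : Fin N => 0 < (l : ℕ)),
          ‖Z l - conj (Z l)‖ ^ 2 * overlapWeight (z 0) (Z l))
      ∂(areaMeasurePi (N - k))

/-- The quotient `D_{1,1}^{(N,1)}(a) / R_{N,1}(a)`, meaningful for non-real `a`: numerator and
denominator both vanish on the real line. -/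
def overlapQuotient (N : ℕ) (a : ℂ) : ℝ :=
  meanDiagonalOverlap N 1 (fun _ => a) / correlation gaussianWeight N 1 (fun _ => a)

open Classical in
/-- The conditional mean diagonal overlap: the quotient off the real line, and its limit from
non-real points (its continuous extension) on the real line. -/
def conditionalOverlap (N : ℕ) (a : ℂ) : ℝ :=
  if a.im ≠ 0 then overlapQuotient N a
  else limUnder (𝓝[{z : ℂ | z.im ≠ 0}] a) (overlapQuotient N)

/-- The skew-kernel of the Gaussian weight. -/
def skewKernel (N : ℕ) (z w : ℂ) : ℂ :=
  (Real.sqrt 2 : ℂ) * ∑ k ∈ Finset.range N, ∑ l ∈ Finset.range (k + 1),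
    (((Real.sqrt 2 : ℂ) * z) ^ (2 * k + 1) / ((2 * k + 1)‼ : ℂ) *
        (((Real.sqrt 2 : ℂ) * w) ^ (2 * l) / ((2 * l)‼ : ℂ)) -
      ((Real.sqrt 2 : ℂ) * w) ^ (2 * k + 1) / ((2 * k + 1)‼ : ℂ) *
        (((Real.sqrt 2 : ℂ) * z) ^ (2 * l) / ((2 * l)‼ : ℂ)))

/-- The rescaled skew-kernel `e^{-2zw} ϰ_N(z, w)`. -/
def skewKernelHat (N : ℕ) (z w : ℂ) : ℂ := Complex.exp (-2 * z * w) * skewKernel N z w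

end GinSE

end

open GinSE

noncomputable section

namespace GinSE

/-! Write N = n + 1. In D/R the prefactor |a - ā|² e^{-2|a|²} N/Z_N is common and cancels off the
real line, leaving the ratio of Z_n^{(over)}(a) to the partition function Y_n(a) of the Gaussian
weight multiplied by |u - a|²|u - ā|² (`overlapQuotient_eq`). Both are continuous in a and positive
on all of ℂ, so the same ratio is the limit at real points.

It remains to express Y_n through the skew-kernel. Let M(x,y) be the unnormalised average of ∏ (x -
w_l)(x - w̄_l)(y - w_l)(y - w̄_l), so that M(a, ā) = Y_n(a). The core is the identity Z_N ϰ_N(x,y) =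
N (x - y) M(x,y) (`partitionFunction_mul_skewKernel`). Up to these constants, both sides reproduce
polynomials of degree below 2N for the same skew form; pairing one kernel with the other and using
antisymmetry shows that they agree, with no Pfaffian and no separate nondegeneracy argument.

For the averaged kernel (`skewForm_meanCharPair`) the reproducing property is Lagrange interpolation
at the 2N nodes z_j, z̄_j: the weight cancels the denominators of the basis polynomials, and
integration turns the sum over nodes into N equal skew pairings. For ϰ_N (`skewForm_skewKernel`) it
follows from the Gaussian moments and a telescoping sum.

At y = ā the identity gives the non-real case. At a real point, ϰ̂_N(x,a) is (x - a) times a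
continuous function, whose value at a is the derivative. -/

instance : areaMeasure.IsAddHaarMeasure := by
  have h : (Real.toNNReal Real.pi)⁻¹ ≠ 0 :=
    inv_ne_zero (Real.toNNReal_pos.mpr Real.pi_pos).ne'
  exact Measure.IsAddHaarMeasure.nnreal_smul volume (pos_iff_ne_zero.mpr h).ne'

/-- Supplies two facts used below: nonempty open sets have positive measure, and proper real
subspaces are null. -/
instance (n : ℕ) : (areaMeasurePi n).IsAddHaarMeasure := by
  unfold areaMeasurePi; infer_instance

/-! ### Functions of polynomial growth -/

/-- `G` is bounded by a polynomial in the norm. -/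
def PolyGrowth {E F : Type*} [NormedAddCommGroup E] [NormedAddCommGroup F] (G : E → F) : Prop :=
  ∃ (C : ℝ) (m : ℕ), 0 ≤ C ∧ ∀ z, ‖G z‖ ≤ C * (1 + ‖z‖) ^ m

namespace PolyGrowth

variable {E E' F : Type*} [NormedAddCommGroup E] [NormedAddCommGroup E'] [NormedAddCommGroup F]

lemma const (c : F) : PolyGrowth (fun _ : E => c) :=
  ⟨‖c‖, 0, norm_nonneg _, fun z => by simp⟩

lemma of_le {G : E → F} (h : ∀ z, ‖G z‖ ≤ ‖z‖) : PolyGrowth G :=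
  ⟨1, 1, zero_le_one, fun z => by
    have := h z
    simp only [pow_one, one_mul]
    linarith⟩

lemma of_norm_le {G : E → F} {H : E → E'} (hH : PolyGrowth H) (h : ∀ z, ‖G z‖ ≤ ‖H z‖) :
    PolyGrowth G := by
  obtain ⟨C, m, hC, hb⟩ := hH
  exact ⟨C, m, hC, fun z => (h z).trans (hb z)⟩

lemma add {G H : E → F} (hG : PolyGrowth G) (hH : PolyGrowth H) :
    PolyGrowth (fun z => G z + H z) := by
  obtain ⟨C, m, hC, hb⟩ := hG
  obtain ⟨C', m', hC', hb'⟩ := hH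
  refine ⟨C + C', m + m', by positivity, fun z => (norm_add_le _ _).trans ?_⟩
  have h1 : (1 : ℝ) ≤ 1 + ‖z‖ := by linarith [norm_nonneg z]
  have e1 : (1 + ‖z‖) ^ m ≤ (1 + ‖z‖) ^ (m + m') := pow_le_pow_right₀ h1 (by omega)
  have e2 : (1 + ‖z‖) ^ m' ≤ (1 + ‖z‖) ^ (m + m') := pow_le_pow_right₀ h1 (by omega)
  calc ‖G z‖ + ‖H z‖ ≤ C * (1 + ‖z‖) ^ m + C' * (1 + ‖z‖) ^ m' := add_le_add (hb z) (hb' z)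
    _ ≤ C * (1 + ‖z‖) ^ (m + m') + C' * (1 + ‖z‖) ^ (m + m') := by gcongr
    _ = _ := by ring

lemma neg {G : E → F} (hG : PolyGrowth G) : PolyGrowth (fun z => -G z) :=
  hG.of_norm_le fun z => by simp

lemma sub {G H : E → F} (hG : PolyGrowth G) (hH : PolyGrowth H) :
    PolyGrowth (fun z => G z - H z) := by
  simpa only [sub_eq_add_neg] using hG.add hH.neg

lemma norm {G : E → F} (hG : PolyGrowth G) : PolyGrowth (fun z => ‖G z‖) :=
  hG.of_norm_le fun z => by simp

lemma comp {G : E → F} (hG : PolyGrowth G) {L : E' → E} (hL : PolyGrowth L) :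
    PolyGrowth (fun z => G (L z)) := by
  obtain ⟨C, m, hC, hb⟩ := hG
  obtain ⟨C', m', hC', hb'⟩ := hL
  refine ⟨C * (1 + C') ^ m, m' * m, by positivity, fun z => (hb _).trans ?_⟩
  have h1 : (1 : ℝ) ≤ (1 + ‖z‖) ^ m' := one_le_pow₀ (by linarith [norm_nonneg z])
  have : 1 + ‖L z‖ ≤ (1 + C') * (1 + ‖z‖) ^ m' := by linarith [hb' z]
  calc C * (1 + ‖L z‖) ^ m ≤ C * ((1 + C') * (1 + ‖z‖) ^ m') ^ m := by gcongr
    _ = _ := by rw [mul_pow, pow_mul]; ring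

variable {A : Type*} [NormedCommRing A]

lemma mul {G H : E → A} (hG : PolyGrowth G) (hH : PolyGrowth H) :
    PolyGrowth (fun z => G z * H z) := by
  obtain ⟨C, m, hC, hb⟩ := hG
  obtain ⟨C', m', hC', hb'⟩ := hH
  refine ⟨C * C', m + m', by positivity, fun z => (norm_mul_le _ _).trans ?_⟩
  calc ‖G z‖ * ‖H z‖ ≤ (C * (1 + ‖z‖) ^ m) * (C' * (1 + ‖z‖) ^ m') :=
        mul_le_mul (hb z) (hb' z) (norm_nonneg _) (by positivity)
    _ = _ := by ring

lemma pow {G : E → A} (hG : PolyGrowth G) (k : ℕ) : PolyGrowth (fun z => G z ^ k) := by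
  induction k with
  | zero => simpa using const (E := E) (1 : A)
  | succ k ih => simpa only [pow_succ] using ih.mul hG

lemma prod {ι : Type*} (s : Finset ι) {G : ι → E → A} (hG : ∀ i, PolyGrowth (G i)) :
    PolyGrowth (fun z => ∏ i ∈ s, G i z) := by
  classical
  induction s using Finset.induction_on with
  | empty => simpa using const (E := E) (1 : A)
  | insert i s hi ih => simpa only [Finset.prod_insert hi] using (hG i).mul ih

lemma sum {ι : Type*} (s : Finset ι) {G : ι → E → F} (hG : ∀ i, PolyGrowth (G i)) :
    PolyGrowth (fun z => ∑ i ∈ s, G i z) := by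
  classical
  induction s using Finset.induction_on with
  | empty => simpa using const (E := E) (0 : F)
  | insert i s hi ih => simpa only [Finset.sum_insert hi] using (hG i).add ih

lemma star {G : E → ℂ} (hG : PolyGrowth G) : PolyGrowth (fun z => conj (G z)) :=
  hG.of_norm_le fun z => by simp

lemma ofReal {G : E → ℝ} (hG : PolyGrowth G) : PolyGrowth (fun z => (G z : ℂ)) :=
  hG.of_norm_le fun z => by simp

lemma id : PolyGrowth (fun z : E => z) := of_le fun _ => le_rfl

lemma fst : PolyGrowth (fun z : E × E' => z.1) := of_le fun z => norm_fst_le z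

lemma snd : PolyGrowth (fun z : E × E' => z.2) := of_le fun z => norm_snd_le z

lemma apply {ι : Type*} [Fintype ι] {G : E → ι → F} (hG : PolyGrowth G) (i : ι) :
    PolyGrowth (fun z => G z i) :=
  hG.of_norm_le fun z => norm_le_pi_norm (G z) i

lemma eval (p : Polynomial ℂ) {G : E → ℂ} (hG : PolyGrowth G) :
    PolyGrowth (fun z => p.eval (G z)) := by
  simp only [Polynomial.eval_eq_sum_range]
  exact sum _ fun i => (const _).mul (hG.pow i)

end PolyGrowth

/-! ### Rapidly decaying weights -/

/-- A continuous non-negative weight all of whose moments are finite. -/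
structure RapidWeight {E : Type*} [NormedAddCommGroup E] [MeasurableSpace E] (μ : Measure E)
    (g : E → ℝ) : Prop where
  continuous : Continuous g
  nonneg : ∀ z, 0 ≤ g z
  moment : ∀ m : ℕ, Integrable (fun z => g z * (1 + ‖z‖) ^ m) μ

namespace RapidWeight

variable {E F : Type*} [NormedAddCommGroup E] [MeasurableSpace E] [BorelSpace E]
  [NormedAddCommGroup F] [NormedSpace ℝ F] {μ : Measure E} {g : E → ℝ}

lemma prod {E' : Type*} [NormedAddCommGroup E'] [MeasurableSpace E'] [BorelSpace E']
    [SecondCountableTopology E'] {ν : Measure E'} [SFinite ν] [SFinite μ] {g' : E' → ℝ}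
    (hg : RapidWeight μ g)
    (hg' : RapidWeight ν g') : RapidWeight (μ.prod ν) (fun p => g p.1 * g' p.2) where
  continuous := (hg.continuous.comp continuous_fst).mul (hg'.continuous.comp continuous_snd)
  nonneg p := mul_nonneg (hg.nonneg _) (hg'.nonneg _)
  moment m := by
    have hc : Continuous fun p : E × E' => g p.1 * g' p.2 * (1 + ‖p‖) ^ m :=
      ((hg.continuous.comp continuous_fst).mul (hg'.continuous.comp continuous_snd)).mul
        (by fun_prop)
    refine ((hg.moment m).mul_prod (hg'.moment m)).mono' hc.aestronglyMeasurable
      (ae_of_all _ fun p => ?_)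
    have h1 := hg.nonneg p.1
    have h2 := hg'.nonneg p.2
    rw [Real.norm_of_nonneg (by positivity)]
    have : 1 + ‖p‖ ≤ (1 + ‖p.1‖) * (1 + ‖p.2‖) := by
      have h0 := norm_nonneg p.1
      have h2 := norm_nonneg p.2
      rcases max_cases ‖p.1‖ ‖p.2‖ with h | h <;> rw [Prod.norm_def] <;> simp only [h.1] <;> nlinarith
    calc g p.1 * g' p.2 * (1 + ‖p‖) ^ m
        ≤ g p.1 * g' p.2 * ((1 + ‖p.1‖) * (1 + ‖p.2‖)) ^ m := by gcongr
      _ = _ := by rw [mul_pow]; ring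

variable [SecondCountableTopology E]

lemma integrable_smul (hg : RapidWeight μ g) {G : E → F} (hc : Continuous G) (hG : PolyGrowth G) :
    Integrable (fun z => g z • G z) μ := by
  obtain ⟨C, m, hC, hb⟩ := hG
  refine ((hg.moment m).const_mul C).mono' (hg.continuous.smul hc).aestronglyMeasurable
    (ae_of_all _ fun z => ?_)
  rw [norm_smul, Real.norm_of_nonneg (hg.nonneg z)]
  calc g z * ‖G z‖ ≤ g z * (C * (1 + ‖z‖) ^ m) := mul_le_mul_of_nonneg_left (hb z) (hg.nonneg z)
    _ = _ := by ring

lemma integrable_mul (hg : RapidWeight μ g) {G : E → ℂ} (hc : Continuous G) (hG : PolyGrowth G) :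
    Integrable (fun z => G z * (g z : ℂ)) μ := by
  refine (hg.integrable_smul hc hG).congr (ae_of_all _ fun z => ?_)
  simp [mul_comm]

/-- Dominated convergence: for ‖a‖ < ‖a₀‖ + 1 the joint polynomial bound splits into a constant
depending on a₀ times a moment of the weight. -/
lemma continuous_integral_smul (hg : RapidWeight μ g) {A : Type*} [NormedAddCommGroup A]
    {G : A × E → F} (hc : Continuous G) (hG : PolyGrowth G) :
    Continuous (fun a => ∫ z, g z • G (a, z) ∂μ) := by
  obtain ⟨C, m, hC, hb⟩ := hG
  refine continuous_iff_continuousAt.mpr fun a₀ => ?_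
  refine continuousAt_of_dominated
    (bound := fun z => C * (2 + ‖a₀‖) ^ m * (g z * (1 + ‖z‖) ^ m)) ?_ ?_
    ((hg.moment m).const_mul _) ?_
  · exact Eventually.of_forall fun a =>
      (hg.continuous.smul (hc.comp (by fun_prop))).aestronglyMeasurable
  · have : ∀ᶠ a in 𝓝 a₀, ‖a‖ < ‖a₀‖ + 1 :=
      (continuous_norm.tendsto a₀).eventually (gt_mem_nhds (by linarith))
    filter_upwards [this] with a ha
    refine ae_of_all _ fun z => ?_
    rw [norm_smul, Real.norm_of_nonneg (hg.nonneg z)]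
    have h1 : 1 + ‖(a, z)‖ ≤ (2 + ‖a₀‖) * (1 + ‖z‖) := by
      have h0 := norm_nonneg z
      have h2 := norm_nonneg a₀
      rcases max_cases ‖a‖ ‖z‖ with h | h <;> rw [Prod.norm_def] <;> simp only [h.1] <;> nlinarith
    calc g z * ‖G (a, z)‖ ≤ g z * (C * ((2 + ‖a₀‖) * (1 + ‖z‖)) ^ m) := by
          refine mul_le_mul_of_nonneg_left ((hb _).trans ?_) (hg.nonneg z)
          gcongr
      _ = _ := by rw [mul_pow]; ring
  · exact ae_of_all _ fun z => Continuous.continuousAt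
      (continuous_const.smul (hc.comp (by fun_prop)))

end RapidWeight

/-! ### Gaussian weights have finite moments -/

/-- The product of the Gaussian weights of the points of a configuration. -/
def gaussianProd {n : ℕ} (z : Fin n → ℂ) : ℝ := ∏ j, gaussianWeight (z j)

lemma gaussianWeight_pos (z : ℂ) : 0 < gaussianWeight z := Real.exp_pos _

lemma gaussianProd_pos {n : ℕ} (z : Fin n → ℂ) : 0 < gaussianProd z :=
  Finset.prod_pos fun _ _ => gaussianWeight_pos _

@[fun_prop]
lemma continuous_gaussianWeight : Continuous gaussianWeight := by
  unfold gaussianWeight; fun_prop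

lemma rapidWeight_gaussianWeight : RapidWeight areaMeasure gaussianWeight where
  continuous := continuous_gaussianWeight
  nonneg z := (gaussianWeight_pos z).le
  moment m := by
    have hi : Integrable (fun z : ℂ => Real.exp (-1 * ‖z‖ ^ 2)) := by
      have := (GaussianFourier.integrable_cexp_neg_mul_sq_norm_add (V := ℂ) (b := 1) (by simp)
        0 0).norm
      refine this.congr (ae_of_all _ fun z => ?_)
      simp [Complex.norm_exp, ← Complex.ofReal_pow]
    have hi' : Integrable (fun z : ℂ => Real.exp (-1 * ‖z‖ ^ 2)) areaMeasure := by
      unfold areaMeasure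
      exact hi.smul_measure (by simp)
    refine (hi'.const_mul ((m ! : ℝ) * Real.exp 2)).mono' (by
      refine Continuous.aestronglyMeasurable ?_
      fun_prop) (ae_of_all _ fun z => ?_)
    have h0 := norm_nonneg z
    rw [Real.norm_of_nonneg (mul_nonneg (gaussianWeight_pos z).le (by positivity))]
    -- The polynomial costs a factor e^{1+r}, absorbed by half of the Gaussian: -2r² + 1 + r ≤ 2 -
    -- r².
    have h1 : (1 + ‖z‖) ^ m ≤ (m ! : ℝ) * Real.exp (1 + ‖z‖) := by
      have := Real.pow_div_factorial_le_exp (1 + ‖z‖) (by positivity) m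
      rw [div_le_iff₀ (by positivity)] at this
      linarith
    calc gaussianWeight z * (1 + ‖z‖) ^ m
        ≤ Real.exp (-2 * ‖z‖ ^ 2) * ((m ! : ℝ) * Real.exp (1 + ‖z‖)) := by
          unfold gaussianWeight; gcongr
      _ = (m ! : ℝ) * Real.exp (-2 * ‖z‖ ^ 2 + (1 + ‖z‖)) := by
          rw [Real.exp_add (-2 * ‖z‖ ^ 2)]; ring
      _ ≤ (m ! : ℝ) * Real.exp (2 + -1 * ‖z‖ ^ 2) := by
          refine mul_le_mul_of_nonneg_left (Real.exp_le_exp.mpr ?_) (by positivity)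
          nlinarith [sq_nonneg (‖z‖ - 1)]
      _ = _ := by rw [Real.exp_add]; ring

lemma rapidWeight_gaussianProd (n : ℕ) :
    RapidWeight (areaMeasurePi n) (gaussianProd (n := n)) where
  continuous := by unfold gaussianProd; fun_prop
  nonneg z := (gaussianProd_pos z).le
  moment m := by
    have hi : Integrable (fun z : Fin n → ℂ => ∏ j, gaussianWeight (z j) * (1 + ‖z j‖) ^ m)
        (areaMeasurePi n) :=
      Integrable.fintype_prod fun _ => rapidWeight_gaussianWeight.moment m
    refine hi.mono' (by
      refine Continuous.aestronglyMeasurable ?_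
      unfold gaussianProd; fun_prop) (ae_of_all _ fun z => ?_)
    rw [Real.norm_of_nonneg (mul_nonneg (gaussianProd_pos z).le (by positivity)),
      Finset.prod_mul_distrib, Finset.prod_pow]
    refine mul_le_mul_of_nonneg_left (pow_le_pow_left₀ (by positivity) ?_ m)
      (gaussianProd_pos z).le
    have hone : ∀ j, (1 : ℝ) ≤ 1 + ‖z j‖ := fun j => by linarith [norm_nonneg (z j)]
    have hs : ∀ s : Finset (Fin n), (1 : ℝ) ≤ ∏ j ∈ s, (1 + ‖z j‖) := fun s => by
      simpa using Finset.prod_le_prod (s := s) (fun _ _ => zero_le_one) fun j _ => hone j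
    have h1 := hs Finset.univ
    -- For the sup norm, 1 + ‖z‖ is at most the product of all 1 + ‖z_j‖, since every factor is at
    -- least 1; the moment bound then factors over the coordinates.
    have h2 : ‖z‖ ≤ ∏ j, (1 + ‖z j‖) - 1 := by
      refine (pi_norm_le_iff_of_nonneg (by linarith)).mpr fun j => ?_
      have := hs (Finset.univ.erase j)
      rw [← Finset.mul_prod_erase _ _ (Finset.mem_univ j)]
      nlinarith [hone j]
    linarith

/-! ### Algebra of the symplectic weight -/

/-- The product over j < l is not visibly symmetric, but its square is a product over all ordered
off-diagonal pairs, which is. Nonnegativity allows the square to be removed. -/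
lemma symplecticWeight_comp_perm (ω : ℂ → ℝ) {n : ℕ} (z : Fin n → ℂ) (σ : Equiv.Perm (Fin n)) :
    symplecticWeight ω (z ∘ σ) = symplecticWeight ω z := by
  have hsq : ∀ y : Fin n → ℂ,
      (∏ j : Fin n, ∏ l ∈ Finset.Ioi j, ‖y j - y l‖ ^ 2 * ‖y j - conj (y l)‖ ^ 2) ^ 2 =
        ∏ j : Fin n, ∏ l : Fin n,
          if l = j then 1 else ‖y l - y j‖ ^ 2 * ‖y l - conj (y j)‖ ^ 2 := by
    intro y
    have h := Finset.prod_prod_Ioi_mul_eq_prod_prod_off_diag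
      (fun l j : Fin n => ‖y l - y j‖ ^ 2 * ‖y l - conj (y j)‖ ^ 2)
    rw [sq, ← Finset.prod_mul_distrib]
    calc _ = ∏ j : Fin n, ∏ l ∈ Finset.Ioi j,
          ‖y l - y j‖ ^ 2 * ‖y l - conj (y j)‖ ^ 2 *
            (‖y j - y l‖ ^ 2 * ‖y j - conj (y l)‖ ^ 2) := by
          refine Finset.prod_congr rfl fun j _ => ?_
          rw [← Finset.prod_mul_distrib]
          refine Finset.prod_congr rfl fun l _ => ?_
          have h1 : ‖y l - conj (y j)‖ = ‖y j - conj (y l)‖ := by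
            rw [← RCLike.norm_conj (y l - conj (y j)), map_sub, Complex.conj_conj, norm_sub_rev]
          rw [norm_sub_rev (y l), h1]
      _ = _ := h
      _ = _ := by
          refine Finset.prod_congr rfl fun j _ => ?_
          rw [Finset.prod_ite, Finset.prod_const_one, one_mul]
          refine Finset.prod_congr ?_ fun _ _ => rfl
          ext l; simp
  have hpair : (∏ j : Fin n, ∏ l ∈ Finset.Ioi j,
      ‖(z ∘ σ) j - (z ∘ σ) l‖ ^ 2 * ‖(z ∘ σ) j - conj ((z ∘ σ) l)‖ ^ 2) =
      ∏ j : Fin n, ∏ l ∈ Finset.Ioi j, ‖z j - z l‖ ^ 2 * ‖z j - conj (z l)‖ ^ 2 := by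
    refine (sq_eq_sq₀ (by positivity) (by positivity)).mp ?_
    rw [hsq, hsq]
    conv_rhs => rw [← Equiv.prod_comp σ]
    refine Finset.prod_congr rfl fun j _ => ?_
    conv_rhs => rw [← Equiv.prod_comp σ]
    simp
  unfold symplecticWeight
  rw [hpair]
  congr 1
  exact Equiv.prod_comp σ (fun j => ‖z j - conj (z j)‖ ^ 2 * ω (z j))

lemma symplecticWeight_cons (ω : ℂ → ℝ) {n : ℕ} (u : ℂ) (w : Fin n → ℂ) :
    symplecticWeight ω (Fin.cons u w : Fin (n + 1) → ℂ) =
      ‖u - conj u‖ ^ 2 * ω u * (∏ l, ‖u - w l‖ ^ 2 * ‖u - conj (w l)‖ ^ 2) *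
        symplecticWeight ω w := by
  unfold symplecticWeight
  simp only [Fin.prod_univ_succ (n := n), Fin.prod_Ioi_succ, Fin.prod_Ioi_zero, Fin.cons_zero,
    Fin.cons_succ]
  ring

lemma symplecticWeight_eq_removeNth (ω : ℂ → ℝ) {n : ℕ} (z : Fin (n + 1) → ℂ) (j : Fin (n + 1)) :
    symplecticWeight ω z =
      ‖z j - conj (z j)‖ ^ 2 * ω (z j) *
        (∏ l, ‖z j - j.removeNth z l‖ ^ 2 * ‖z j - conj (j.removeNth z l)‖ ^ 2) *
        symplecticWeight ω (j.removeNth z) := by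
  rw [← symplecticWeight_cons, ← symplecticWeight_comp_perm ω (Fin.cons _ _) j.cycleRange,
    Fin.cons_comp_cycleRange, Fin.insertNth_self_removeNth]

lemma symplecticWeight_mul (q ω : ℂ → ℝ) {n : ℕ} (z : Fin n → ℂ) :
    symplecticWeight (fun u => q u * ω u) z = (∏ l, q (z l)) * symplecticWeight ω z := by
  unfold symplecticWeight
  simp only [Finset.prod_mul_distrib]
  ring

lemma symplecticWeight_mul_gaussian (q : ℂ → ℝ) {n : ℕ} (z : Fin n → ℂ) :
    symplecticWeight (fun u => q u * gaussianWeight u) z =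
      gaussianProd z * symplecticWeight q z := by
  unfold symplecticWeight gaussianProd
  simp only [Finset.prod_mul_distrib]
  ring

lemma symplecticWeight_gaussian {n : ℕ} (z : Fin n → ℂ) :
    symplecticWeight gaussianWeight z = gaussianProd z * symplecticWeight 1 z := by
  rw [← symplecticWeight_mul_gaussian]
  simp

lemma continuous_symplecticWeight {E : Type*} [TopologicalSpace E] {n : ℕ} {q : E → ℂ → ℝ}
    {Z : E → Fin n → ℂ} (hZ : Continuous Z) (hq : ∀ j, Continuous fun e => q e (Z e j)) :
    Continuous fun e => symplecticWeight (q e) (Z e) := by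
  unfold symplecticWeight
  have hz : ∀ j, Continuous fun e => Z e j := fun j => (continuous_apply j).comp hZ
  have hcz : ∀ j, Continuous fun e => conj (Z e j) := fun j => Complex.continuous_conj.comp (hz j)
  exact .mul (continuous_finsetProd _ fun j _ => continuous_finsetProd _ fun l _ =>
    .mul (.pow (.norm (.sub (hz j) (hz l))) _) (.pow (.norm (.sub (hz j) (hcz l))) _))
    (continuous_finsetProd _ fun j _ => .mul (.pow (.norm (.sub (hz j) (hcz j))) _) (hq j))

lemma polyGrowth_symplecticWeight {E : Type*} [NormedAddCommGroup E] {n : ℕ} {q : E → ℂ → ℝ}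
    {Z : E → Fin n → ℂ} (hZ : PolyGrowth Z) (hq : ∀ j, PolyGrowth fun e => q e (Z e j)) :
    PolyGrowth fun e => symplecticWeight (q e) (Z e) := by
  unfold symplecticWeight
  have hz := hZ.apply
  exact .mul (.prod _ fun j => .prod _ fun l => .mul (.pow (.norm (.sub (hz j) (hz l))) _)
    (.pow (.norm (.sub (hz j) (hz l).star)) _)) (.prod _ fun j =>
      .mul (.pow (.norm (.sub (hz j) (hz j).star)) _) (hq j))

/-! ### Partition functions: continuity in a parameter and positivity -/

lemma continuous_partitionFunction {A : Type*} [NormedAddCommGroup A] {q : A × ℂ → ℝ}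
    (hc : Continuous q) (hq : PolyGrowth q) (n : ℕ) :
    Continuous fun a => partitionFunction (fun u => q (a, u) * gaussianWeight u) n := by
  unfold partitionFunction
  simp only [symplecticWeight_mul_gaussian]
  exact (rapidWeight_gaussianProd n).continuous_integral_smul
    (G := fun p : A × (Fin n → ℂ) => symplecticWeight (fun u => q (p.1, u)) p.2)
    (continuous_symplecticWeight continuous_snd fun j => by fun_prop)
    (polyGrowth_symplecticWeight PolyGrowth.snd fun j => hq.comp
      (PolyGrowth.id.of_norm_le fun p => by
        rw [Prod.norm_def, Prod.norm_def]
        exact max_le_max le_rfl (norm_le_pi_norm p.2 j)))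

lemma symplecticWeight_nonneg {q : ℂ → ℝ} (hq : ∀ u, 0 ≤ q u) {n : ℕ} (z : Fin n → ℂ) :
    0 ≤ symplecticWeight q z := by
  unfold symplecticWeight
  have h : ∀ j, 0 ≤ ‖z j - conj (z j)‖ ^ 2 * q (z j) := fun j => mul_nonneg (by positivity) (hq _)
  exact mul_nonneg (by positivity) (Finset.prod_nonneg fun j _ => h j)

/-- The integrand is continuous and nonnegative, so one configuration where it is positive suffices.
Positivity of `q` is asked only far out because the overlap and insertion factors vanish at some
points. -/
lemma partitionFunction_pos {q : ℂ → ℝ} (hc : Continuous q) (hg : PolyGrowth q)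
    (h0 : ∀ u, 0 ≤ q u) (R : ℝ) (hR : ∀ u, R < ‖u‖ → 0 < q u) (n : ℕ) :
    0 < partitionFunction (fun u => q u * gaussianWeight u) n := by
  unfold partitionFunction
  simp only [symplecticWeight_mul_gaussian]
  have hcont : Continuous fun z : Fin n → ℂ => symplecticWeight q z :=
    continuous_symplecticWeight continuous_id fun j => hc.comp (continuous_apply j)
  have hpg : PolyGrowth fun z : Fin n → ℂ => symplecticWeight q z :=
    polyGrowth_symplecticWeight PolyGrowth.id fun j => hg.comp (PolyGrowth.id.apply j)
  have hnn : ∀ z : Fin n → ℂ, 0 ≤ gaussianProd z * symplecticWeight q z := fun z =>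
    mul_nonneg (gaussianProd_pos z).le (symplecticWeight_nonneg h0 z)
  have hw := rapidWeight_gaussianProd n
  rw [integral_pos_iff_support_of_nonneg hnn (hw.integrable_smul hcont hpg)]
  refine IsOpen.measure_pos _ (hw.continuous.mul hcont).isOpen_support ?_
  -- Distinct heights in the upper half-plane above |R|: no two points coincide or are conjugate,
  -- none is real, and all have norm larger than R.
  set z : Fin n → ℂ := fun j => (((|R| + 1 + (j : ℕ) : ℝ)) : ℂ) * Complex.I with hz
  have him : ∀ j, (z j).im = |R| + 1 + (j : ℕ) := fun j => by simp [hz]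
  have habs := abs_nonneg R
  refine ⟨z, ne_of_gt (mul_pos (gaussianProd_pos z) ?_)⟩
  unfold symplecticWeight
  refine mul_pos (Finset.prod_pos fun j _ => Finset.prod_pos fun l hl => ?_)
    (Finset.prod_pos fun j _ => ?_)
  · have h1 : z j - z l ≠ 0 := fun h => by
      have := congrArg Complex.im h
      rw [Complex.sub_im, him, him, Complex.zero_im] at this
      have h3 : (j : ℕ) < l := by simpa using hl
      have h2 : ((j : ℕ) : ℝ) < (l : ℕ) := by exact_mod_cast h3
      linarith
    have h2 : z j - conj (z l) ≠ 0 := fun h => by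
      have := congrArg Complex.im h
      rw [Complex.sub_im, Complex.conj_im, him, him, Complex.zero_im] at this
      have h3 : (0 : ℝ) ≤ (j : ℕ) := by positivity
      have h4 : (0 : ℝ) ≤ (l : ℕ) := by positivity
      linarith
    exact mul_pos (pow_pos (norm_pos_iff.mpr h1) 2) (pow_pos (norm_pos_iff.mpr h2) 2)
  · have h3 : (0 : ℝ) ≤ (j : ℕ) := by positivity
    have h2 : z j - conj (z j) ≠ 0 := fun h => by
      have := congrArg Complex.im h
      rw [Complex.sub_im, Complex.conj_im, him, Complex.zero_im] at this
      linarith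
    refine mul_pos (pow_pos (norm_pos_iff.mpr h2) 2) (hR _ ?_)
    have := Complex.abs_im_le_norm (z j)
    rw [him, abs_of_pos (by linarith)] at this
    linarith [le_abs_self R]

/-! ### Splitting off one point -/

lemma integral_removeNth {n : ℕ} (j : Fin (n + 1)) {H : ℂ × (Fin n → ℂ) → ℂ}
    (hH : Integrable H (areaMeasure.prod (areaMeasurePi n))) :
    Integrable (fun z : Fin (n + 1) → ℂ => H (z j, j.removeNth z)) (areaMeasurePi (n + 1)) ∧
    ∫ z : Fin (n + 1) → ℂ, H (z j, j.removeNth z) ∂(areaMeasurePi (n + 1)) =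
      ∫ u, ∫ w, H (u, w) ∂(areaMeasurePi n) ∂areaMeasure := by
  have hmp := measurePreserving_piFinSuccAbove (α := fun _ : Fin (n + 1) => ℂ)
    (fun _ => areaMeasure) j
  constructor
  · exact (hmp.integrable_comp_emb (MeasurableEquiv.measurableEmbedding _)).mpr hH
  · rw [← integral_prod _ hH]
    exact hmp.integral_comp (MeasurableEquiv.measurableEmbedding _) H

/-! ### Averages of products of characteristic polynomials -/

/-- The product `∏_l (x - w_l)(x - conj w_l)(y - w_l)(y - conj w_l)`. -/
def charPair {n : ℕ} (x y : ℂ) (w : Fin n → ℂ) : ℂ :=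
  ∏ l, (x - w l) * (x - conj (w l)) * ((y - w l) * (y - conj (w l)))

/-- The unnormalised Gaussian average of `charPair x y`. -/
def meanCharPair (n : ℕ) (x y : ℂ) : ℂ :=
  ∫ w : Fin n → ℂ, charPair x y w * (symplecticWeight gaussianWeight w : ℂ) ∂(areaMeasurePi n)

/-- The skew form of the Gaussian weight. -/
def skewForm (f h : ℂ → ℂ) : ℂ :=
  ∫ u, (f u * h (conj u) - f (conj u) * h u) * (u - conj u) * (gaussianWeight u : ℂ) ∂areaMeasure

section Regularity

variable {E : Type*} {n : ℕ} {x y : E → ℂ} {w : E → Fin n → ℂ}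

lemma continuous_charPair [TopologicalSpace E] (hx : Continuous x) (hy : Continuous y)
    (hw : Continuous w) : Continuous fun e => charPair (x e) (y e) (w e) := by
  unfold charPair
  have hz : ∀ j, Continuous fun e => w e j := fun j => (continuous_apply j).comp hw
  have hcz : ∀ j, Continuous fun e => conj (w e j) := fun j => Complex.continuous_conj.comp (hz j)
  exact continuous_finsetProd _ fun l _ => .mul (.mul (.sub hx (hz l)) (.sub hx (hcz l)))
    (.mul (.sub hy (hz l)) (.sub hy (hcz l)))

lemma polyGrowth_charPair [NormedAddCommGroup E] (hx : PolyGrowth x) (hy : PolyGrowth y)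
    (hw : PolyGrowth w) : PolyGrowth fun e => charPair (x e) (y e) (w e) := by
  unfold charPair
  have hz := hw.apply
  exact .prod _ fun l => .mul (.mul (.sub hx (hz l)) (.sub hx (hz l).star))
    (.mul (.sub hy (hz l)) (.sub hy (hz l).star))

lemma continuous_symplecticWeight_one [TopologicalSpace E] (hw : Continuous w) :
    Continuous fun e => (symplecticWeight 1 (w e) : ℂ) :=
  Complex.continuous_ofReal.comp
    (continuous_symplecticWeight (q := fun _ => 1) hw fun _ => continuous_const)

lemma polyGrowth_symplecticWeight_one [NormedAddCommGroup E] (hw : PolyGrowth w) :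
    PolyGrowth fun e => (symplecticWeight 1 (w e) : ℂ) :=
  (polyGrowth_symplecticWeight (q := fun _ => 1) hw fun _ => PolyGrowth.const _).ofReal

end Regularity

lemma integrable_charPair {n : ℕ} (x y : ℂ) :
    Integrable (fun w : Fin n → ℂ => charPair x y w * (symplecticWeight gaussianWeight w : ℂ))
      (areaMeasurePi n) := by
  have h := (rapidWeight_gaussianProd n).integrable_mul
    (G := fun w => charPair x y w * (symplecticWeight 1 w : ℂ))
    ((continuous_charPair continuous_const continuous_const continuous_id).mul
      (continuous_symplecticWeight_one continuous_id))
    ((polyGrowth_charPair (.const _) (.const _) .id).mul (polyGrowth_symplecticWeight_one .id))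
  refine h.congr (ae_of_all _ fun w => ?_)
  simp only [symplecticWeight_gaussian, Complex.ofReal_mul]
  ring

lemma continuous_meanCharPair (n : ℕ) :
    Continuous fun p : ℂ × ℂ => meanCharPair n p.1 p.2 := by
  have h := (rapidWeight_gaussianProd n).continuous_integral_smul
    (G := fun p : (ℂ × ℂ) × (Fin n → ℂ) =>
      charPair p.1.1 p.1.2 p.2 * (symplecticWeight 1 p.2 : ℂ))
    ((continuous_charPair (by fun_prop) (by fun_prop) continuous_snd).mul
      (continuous_symplecticWeight_one continuous_snd))
    ((polyGrowth_charPair (PolyGrowth.fst.comp .fst) (PolyGrowth.snd.comp .fst) .snd).mul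
      (polyGrowth_symplecticWeight_one .snd))
  refine h.congr fun p => ?_
  unfold meanCharPair
  refine integral_congr_ae (ae_of_all _ fun w => ?_)
  simp only [symplecticWeight_gaussian, Complex.ofReal_mul, Complex.real_smul]
  ring

/-! ### Lagrange interpolation at the points of a configuration and their conjugates -/

/-- The points of the configuration (`false`) and their complex conjugates (`true`). -/
def node {n : ℕ} (z : Fin n → ℂ) (i : Fin n × Bool) : ℂ := if i.2 then conj (z i.1) else z i.1

/-- Each coincidence of two nodes is a real-linear condition that cuts out a proper subspace, hence
a null set. -/
lemma ae_injective_node (n : ℕ) :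
    ∀ᵐ z : Fin n → ℂ ∂(areaMeasurePi n), Function.Injective (node z) := by
  have key : ∀ i k : Fin n × Bool, i ≠ k →
      ∀ᵐ z : Fin n → ℂ ∂(areaMeasurePi n), node z i ≠ node z k := by
    intro i k hik
    let S : Submodule ℝ (Fin n → ℂ) :=
      { carrier := {z | node z i = node z k}
        zero_mem' := by simp [node]
        add_mem' := by
          rintro a b (ha : node a i = node a k) (hb : node b i = node b k)
          have hadd : ∀ m, node (a + b) m = node a m + node b m := fun m => by
            unfold node; split <;> simp
          simp only [Set.mem_ofPred_eq, hadd, ha, hb]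
        smul_mem' := by
          rintro c a (ha : node a i = node a k)
          have hsmul : ∀ m, node (c • a) m = (c : ℂ) * node a m := fun m => by
            unfold node; split <;> simp
          simp only [Set.mem_ofPred_eq, hsmul, ha] }
    have hS : S ≠ ⊤ := by
      intro h
      -- The nodes of this configuration are ±(l+1)i, all distinct; the shift by 1 separates the
      -- first point from its conjugate.
      have hm : (fun l : Fin n => (((l : ℕ) + 1 : ℝ) : ℂ) * Complex.I) ∈ S := h ▸ Submodule.mem_top
      have him := congrArg Complex.im (show node _ i = node _ k from hm)
      apply hik
      obtain ⟨i, b⟩ := i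
      obtain ⟨k, c⟩ := k
      have hi : (0 : ℝ) ≤ (i : ℕ) := by positivity
      have hk : (0 : ℝ) ≤ (k : ℕ) := by positivity
      cases b <;> cases c <;> simp [node] at him
      · simpa [Fin.ext_iff] using him
      · linarith
      · linarith
      · simpa [Fin.ext_iff] using him
    have h0 := Measure.addHaar_submodule (areaMeasurePi n) S hS
    exact measure_eq_zero_iff_ae_notMem.mp h0
  have hall : ∀ᵐ z : Fin n → ℂ ∂(areaMeasurePi n),
      ∀ i k : Fin n × Bool, i ≠ k → node z i ≠ node z k := by
    rw [ae_all_iff]; intro i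
    rw [ae_all_iff]; intro k
    by_cases h : i = k
    · exact ae_of_all _ fun z h' => (h' h).elim
    · filter_upwards [key i k h] with z hz _ using hz
  filter_upwards [hall] with z hz i k hik
  by_contra hne
  exact hz i k hne hik

lemma ofReal_norm_sq (a : ℂ) : ((‖a‖ ^ 2 : ℝ) : ℂ) = a * conj a := by
  rw [Complex.mul_conj, Complex.normSq_eq_norm_sq]

/-- Splits the squared moduli into linear factors in a node p and its conjugate, so that the factors
vanishing at coincidences with p can later be cancelled. -/
lemma symplecticWeight_eq_node {n : ℕ} (z : Fin (n + 1) → ℂ) (j : Fin (n + 1)) (b : Bool) :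
    (symplecticWeight gaussianWeight z : ℂ) =
      (node z (j, b) - node z (j, !b)) * (node z (j, !b) - node z (j, b)) * gaussianWeight (z j) *
        charPair (node z (j, b)) (node z (j, !b)) (j.removeNth z) *
        symplecticWeight gaussianWeight (j.removeNth z) := by
  rw [symplecticWeight_eq_removeNth gaussianWeight z j]
  unfold charPair
  simp only [Complex.ofReal_mul, Complex.ofReal_prod, ofReal_norm_sq, map_sub, Complex.conj_conj]
  congr 2
  · cases b <;>
      simp only [node, Bool.not_true, Bool.not_false, if_true, if_false, Bool.false_eq_true] <;> ring
  · refine Finset.prod_congr rfl fun l _ => ?_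
    cases b <;>
      simp only [node, Bool.not_true, Bool.not_false, if_true, if_false, Bool.false_eq_true] <;> ring

/-- The denominator of the basis polynomial at a node p is the product of p minus every other node,
and these factors all occur in the weight. Multiplication thus replaces p by x in them, leaving p̄
untouched. -/
lemma eval_basis_mul_symplecticWeight {n : ℕ} {z : Fin (n + 1) → ℂ}
    (hz : Function.Injective (node z)) (x : ℂ) (j : Fin (n + 1)) (b : Bool) :
    (Lagrange.basis Finset.univ (node z) (j, b)).eval x *
        (symplecticWeight gaussianWeight z : ℂ) =
      (node z (j, !b) - node z (j, b)) * (x - node z (j, !b)) *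
        charPair x (node z (j, !b)) (j.removeNth z) *
        (gaussianWeight (z j) * symplecticWeight gaussianWeight (j.removeNth z)) := by
  have hb : (Lagrange.basis Finset.univ (node z) (j, b)).eval x =
      (node z (j, b) - node z (j, !b))⁻¹ * (x - node z (j, !b)) *
        ∏ l, ((node z (j, b) - j.removeNth z l)⁻¹ * (x - j.removeNth z l)) *
          ((node z (j, b) - conj (j.removeNth z l))⁻¹ * (x - conj (j.removeNth z l))) := by
    unfold Lagrange.basis
    rw [Polynomial.eval_prod]
    simp only [Lagrange.basisDivisor, Polynomial.eval_mul, Polynomial.eval_C, Polynomial.eval_sub,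
      Polynomial.eval_X]
    -- Filling the erased index with 1 makes the product range over all of `Fin (n + 1) × Bool`,
    -- where the pair at j can be split off.
    have he : ∀ r : Fin (n + 1) × Bool → ℂ,
        ∏ i ∈ Finset.univ.erase (j, b), r i = ∏ i, if i = (j, b) then 1 else r i := fun r => by
      rw [← Finset.mul_prod_erase Finset.univ _ (Finset.mem_univ (j, b)), if_pos rfl, one_mul]
      exact Finset.prod_congr rfl fun i hi => (if_neg (Finset.ne_of_mem_erase hi)).symm
    rw [he, Fintype.prod_prod_type, Fin.prod_univ_succAbove _ j]
    congr 1
    · cases b <;> simp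
    · refine Finset.prod_congr rfl fun l _ => ?_
      rw [Fintype.prod_bool]
      simp [Fin.succAbove_ne, node, Fin.removeNth, mul_comm]
  have h1 : node z (j, b) - node z (j, !b) ≠ 0 := sub_ne_zero.mpr fun h => by
    simpa using hz h
  have h2 : ∀ l, node z (j, b) - j.removeNth z l ≠ 0 := fun l => sub_ne_zero.mpr fun h => by
    have := congrArg Prod.fst (hz (show node z (j, b) = node z (j.succAbove l, false) from h))
    exact Fin.succAbove_ne _ _ this.symm
  have h3 : ∀ l, node z (j, b) - conj (j.removeNth z l) ≠ 0 := fun l => sub_ne_zero.mpr fun h => by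
    have := congrArg Prod.fst (hz (show node z (j, b) = node z (j.succAbove l, true) from h))
    exact Fin.succAbove_ne _ _ this.symm
  have hp : (∏ l, ((node z (j, b) - j.removeNth z l)⁻¹ * (x - j.removeNth z l)) *
      ((node z (j, b) - conj (j.removeNth z l))⁻¹ * (x - conj (j.removeNth z l)))) *
      charPair (node z (j, b)) (node z (j, !b)) (j.removeNth z) =
      charPair x (node z (j, !b)) (j.removeNth z) := by
    unfold charPair
    rw [← Finset.prod_mul_distrib]
    refine Finset.prod_congr rfl fun l _ => ?_
    have := h2 l
    have := h3 l
    field_simp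
  rw [hb, symplecticWeight_eq_node z j b, ← hp]
  field_simp

lemma eval_mul_symplecticWeight {n : ℕ} {z : Fin (n + 1) → ℂ} (hz : Function.Injective (node z))
    {f : Polynomial ℂ} (hf : f.degree < (2 * (n + 1) : ℕ)) (x : ℂ) :
    f.eval x * (symplecticWeight gaussianWeight z : ℂ) =
      ∑ j, (f.eval (conj (z j)) * (x - z j) * charPair x (z j) (j.removeNth z) -
          f.eval (z j) * (x - conj (z j)) * charPair x (conj (z j)) (j.removeNth z)) *
        (z j - conj (z j)) *
        (gaussianWeight (z j) * symplecticWeight gaussianWeight (j.removeNth z)) := by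
  have h := Lagrange.eq_interpolate (s := Finset.univ) (v := node z) (f := f) hz.injOn
    (by simpa [mul_comm] using hf)
  rw [Lagrange.interpolate_apply] at h
  have h' := congrArg (Polynomial.eval x) h
  simp only [Polynomial.eval_finsetSum, Polynomial.eval_mul, Polynomial.eval_C] at h'
  rw [h', Finset.sum_mul, Fintype.sum_prod_type]
  refine Finset.sum_congr rfl fun j _ => ?_
  rw [Fintype.sum_bool]
  simp only [mul_assoc, eval_basis_mul_symplecticWeight hz]
  simp only [node, Bool.not_true, Bool.not_false, if_true, Bool.false_eq_true, if_false]
  ring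

/-! ### The reproducing property of the averaged kernel -/

/-- Integrate the interpolation identity, valid almost everywhere. In the j-th term, integrating out
the points other than z_j turns `charPair` into its average, and the remaining integral is the skew
form, independent of j. -/
lemma skewForm_meanCharPair (n : ℕ) {f : Polynomial ℂ} (hf : f.degree < (2 * (n + 1) : ℕ))
    (x : ℂ) :
    ((n : ℂ) + 1) * skewForm (fun y => (x - y) * meanCharPair n x y) (fun y => f.eval y) =
      partitionFunction gaussianWeight (n + 1) * f.eval x := by
  set H : ℂ × (Fin n → ℂ) → ℂ := fun p =>
    (f.eval (conj p.1) * (x - p.1) * charPair x p.1 p.2 -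
        f.eval p.1 * (x - conj p.1) * charPair x (conj p.1) p.2) * (p.1 - conj p.1) *
      (gaussianWeight p.1 * symplecticWeight gaussianWeight p.2) with hHdef
  have hH : Integrable H (areaMeasure.prod (areaMeasurePi n)) := by
    have c1 : Continuous fun p : ℂ × (Fin n → ℂ) => p.1 := continuous_fst
    have c2 : Continuous fun p : ℂ × (Fin n → ℂ) => conj p.1 := Complex.continuous_conj.comp c1
    have g1 : PolyGrowth fun p : ℂ × (Fin n → ℂ) => p.1 := .fst
    have h := (rapidWeight_gaussianWeight.prod (rapidWeight_gaussianProd n)).integrable_mul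
      (G := fun p => (f.eval (conj p.1) * (x - p.1) * charPair x p.1 p.2 -
        f.eval p.1 * (x - conj p.1) * charPair x (conj p.1) p.2) * (p.1 - conj p.1) *
        (symplecticWeight 1 p.2 : ℂ))
      ((((((f.continuous.comp c2).mul (continuous_const.sub c1)).mul
        (continuous_charPair continuous_const c1 continuous_snd)).sub
        (((f.continuous.comp c1).mul (continuous_const.sub c2)).mul
        (continuous_charPair continuous_const c2 continuous_snd))).mul (c1.sub c2)).mul
        (continuous_symplecticWeight_one continuous_snd))
      ((((((PolyGrowth.eval f g1.star).mul (.sub (.const _) g1)).mul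
        (polyGrowth_charPair (.const _) g1 .snd)).sub
        (((PolyGrowth.eval f g1).mul (.sub (.const _) g1.star)).mul
        (polyGrowth_charPair (.const _) g1.star .snd))).mul (g1.sub g1.star)).mul
        (polyGrowth_symplecticWeight_one .snd))
    refine h.congr (ae_of_all _ fun p => ?_)
    simp only [hHdef, symplecticWeight_gaussian, Complex.ofReal_mul]
    ring
  have hin : ∀ u, ∫ w, H (u, w) ∂(areaMeasurePi n) =
      ((x - u) * meanCharPair n x u * f.eval (conj u) -
        (x - conj u) * meanCharPair n x (conj u) * f.eval u) * (u - conj u) *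
        (gaussianWeight u : ℂ) := by
    intro u
    have e : ∀ w : Fin n → ℂ, H (u, w) =
        (f.eval (conj u) * (x - u) * (u - conj u) * gaussianWeight u) *
          (charPair x u w * (symplecticWeight gaussianWeight w : ℂ)) -
        (f.eval u * (x - conj u) * (u - conj u) * gaussianWeight u) *
          (charPair x (conj u) w * (symplecticWeight gaussianWeight w : ℂ)) := fun w => by
      simp only [hHdef]; ring
    simp only [e]
    rw [integral_sub ((integrable_charPair _ _).const_mul _)
      ((integrable_charPair _ _).const_mul _), integral_const_mul, integral_const_mul]
    unfold meanCharPair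
    ring
  have hsum : ∫ z : Fin (n + 1) → ℂ, f.eval x * (symplecticWeight gaussianWeight z : ℂ)
      ∂(areaMeasurePi (n + 1)) = ∑ _j : Fin (n + 1),
        skewForm (fun y => (x - y) * meanCharPair n x y) (fun y => f.eval y) := by
    calc _ = ∫ z : Fin (n + 1) → ℂ, ∑ j, H (z j, j.removeNth z) ∂(areaMeasurePi (n + 1)) := by
          refine integral_congr_ae ?_
          filter_upwards [ae_injective_node (n + 1)] with z hz
          exact eval_mul_symplecticWeight hz hf x
      _ = ∑ j, ∫ z : Fin (n + 1) → ℂ, H (z j, j.removeNth z) ∂(areaMeasurePi (n + 1)) :=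
          integral_finsetSum _ fun j _ => (integral_removeNth j hH).1
      _ = _ := by
          refine Finset.sum_congr rfl fun j _ => ?_
          rw [(integral_removeNth j hH).2]
          simp only [hin]
          rfl
  rw [integral_const_mul, integral_complex_ofReal] at hsum
  rw [Finset.sum_const, Finset.card_univ, Fintype.card_fin, nsmul_eq_mul] at hsum
  push_cast at hsum
  rw [← hsum, mul_comm]
  rfl

/-! ### Gaussian moments -/

lemma integral_areaMeasure (f : ℂ → ℂ) : ∫ u, f u ∂areaMeasure = (Real.pi : ℂ)⁻¹ * ∫ u, f u := by
  unfold areaMeasure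
  rw [integral_smul_nnreal_measure, NNReal.smul_def, NNReal.coe_inv,
    Real.coe_toNNReal _ Real.pi_pos.le, Complex.real_smul, Complex.ofReal_inv]

lemma integral_pow_mul_conj_pow (p q : ℕ) :
    ∫ u, u ^ p * conj u ^ q * (gaussianWeight u : ℂ) ∂areaMeasure =
      if p = q then (p ! : ℂ) / 2 ^ (p + 1) else 0 := by
  rw [integral_areaMeasure]
  split_ifs with h
  · subst h
    have h1 := Complex.integral_rpow_mul_exp_neg_mul_rpow (p := 2) (q := 2 * p) (b := 2)
      (by norm_num) (by linarith [(Nat.cast_nonneg p : (0 : ℝ) ≤ p)]) (by norm_num)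
    have h2 : ∀ u : ℂ, u ^ p * conj u ^ p * (gaussianWeight u : ℂ) =
        ((‖u‖ ^ (2 * p : ℝ) * Real.exp (-2 * ‖u‖ ^ (2 : ℝ)) : ℝ) : ℂ) := fun u => by
      have e1 : ‖u‖ ^ (2 * p : ℝ) = (‖u‖ ^ 2) ^ p := by
        rw [← pow_mul, ← Real.rpow_natCast]; norm_num
      rw [e1, Real.rpow_two, Complex.ofReal_mul, Complex.ofReal_pow, ofReal_norm_sq, mul_pow]
      rfl
    simp only [h2]
    rw [integral_complex_ofReal, h1]
    have e2 : (2 * (p : ℝ) + 2) / 2 = p + 1 := by ring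
    have e3 : -(2 * (p : ℝ) + 2) / 2 = -((p + 1 : ℕ) : ℝ) := by push_cast; ring
    rw [e2, e3, Real.Gamma_nat_eq_factorial, Real.rpow_neg zero_le_two, Real.rpow_natCast]
    have := Real.pi_ne_zero
    push_cast
    field_simp
  · have hpq : (p : ℝ) - q ≠ 0 := sub_ne_zero.mpr (by exact_mod_cast h)
    -- Rotation by the angle π/(p - q) changes the sign of u^p ū^q and preserves the weight and the
    -- measure, so the integral equals its negative.
    set c : Circle := Circle.exp (Real.pi / (p - q)) with hc
    have hc1 : (c : ℂ) ^ p * conj (c : ℂ) ^ q = -1 := by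
      rw [hc, Circle.coe_exp, ← Complex.exp_conj, ← Complex.exp_nat_mul, ← Complex.exp_nat_mul,
        ← Complex.exp_add, ← Complex.exp_pi_mul_I]
      congr 1
      have : (p : ℂ) - q ≠ 0 := by exact_mod_cast hpq
      simp only [map_mul, Complex.conj_ofReal, Complex.conj_I]
      push_cast
      field_simp
      ring
    have hrot := (LinearIsometryEquiv.measurePreserving (rotation c)).integral_comp
      (rotation c).toHomeomorph.measurableEmbedding
      (fun u : ℂ => u ^ p * conj u ^ q * (gaussianWeight u : ℂ))
    have e : ∀ u : ℂ, (rotation c u) ^ p * conj (rotation c u) ^ q *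
        (gaussianWeight (rotation c u) : ℂ) = -1 * (u ^ p * conj u ^ q * (gaussianWeight u : ℂ)) :=
      fun u => by
        rw [← hc1]
        simp only [gaussianWeight, LinearIsometryEquiv.norm_map]
        simp only [rotation_apply, map_mul, mul_pow]
        ring
    simp only [e] at hrot
    rw [integral_const_mul] at hrot
    have : ∫ u : ℂ, u ^ p * conj u ^ q * (gaussianWeight u : ℂ) = 0 := by
      linear_combination (-1 / 2 : ℂ) * hrot
    rw [this, mul_zero]

lemma integrable_eval_mul_conj (f h : Polynomial ℂ) :
    Integrable (fun u => (f.eval u * h.eval (conj u) - f.eval (conj u) * h.eval u) *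
      (u - conj u) * (gaussianWeight u : ℂ)) areaMeasure := by
  have cc : Continuous fun u : ℂ => conj u := Complex.continuous_conj
  exact rapidWeight_gaussianWeight.integrable_mul
    (G := fun u => (f.eval u * h.eval (conj u) - f.eval (conj u) * h.eval u) * (u - conj u))
    (((f.continuous.mul (h.continuous.comp cc)).sub
      ((f.continuous.comp cc).mul h.continuous)).mul (continuous_id.sub cc))
    ((((PolyGrowth.eval f .id).mul (PolyGrowth.eval h PolyGrowth.id.star)).sub
      ((PolyGrowth.eval f PolyGrowth.id.star).mul (PolyGrowth.eval h .id))).mul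
      (.sub .id PolyGrowth.id.star))

lemma skewForm_antisymm (f h : ℂ → ℂ) : skewForm f h = -skewForm h f := by
  unfold skewForm
  rw [← integral_neg]
  congr 1
  ext u
  ring

lemma skewForm_add_left (f f' h : Polynomial ℂ) :
    skewForm (fun y => (f + f').eval y) (fun y => h.eval y) =
      skewForm (fun y => f.eval y) (fun y => h.eval y) +
        skewForm (fun y => f'.eval y) (fun y => h.eval y) := by
  unfold skewForm
  rw [← integral_add (integrable_eval_mul_conj f h) (integrable_eval_mul_conj f' h)]
  congr 1
  ext u
  simp only [Polynomial.eval_add]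
  ring

lemma skewForm_smul_left (c : ℂ) (f h : Polynomial ℂ) :
    skewForm (fun y => (c • f).eval y) (fun y => h.eval y) =
      c • skewForm (fun y => f.eval y) (fun y => h.eval y) := by
  unfold skewForm
  rw [smul_eq_mul, ← integral_const_mul]
  congr 1
  ext u
  simp only [Polynomial.eval_smul, smul_eq_mul]
  ring

/-- The skew form on polynomials, as a bilinear map. -/
def skewFormPoly : Polynomial ℂ →ₗ[ℂ] Polynomial ℂ →ₗ[ℂ] ℂ :=
  LinearMap.mk₂ ℂ (fun f h => skewForm (fun y => f.eval y) (fun y => h.eval y))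
    skewForm_add_left skewForm_smul_left
    (fun f h h' => by
      rw [skewForm_antisymm, skewForm_add_left, neg_add, ← skewForm_antisymm, ← skewForm_antisymm])
    (fun c f h => by
      rw [skewForm_antisymm, skewForm_smul_left, ← smul_neg, ← skewForm_antisymm])

lemma skewFormPoly_apply (f h : Polynomial ℂ) :
    skewFormPoly f h = skewForm (fun y => f.eval y) (fun y => h.eval y) := rfl

/-- Expanding the factor u - ū gives four moments, which survive only for consecutive exponents and
then in equal pairs. -/
lemma skewFormPoly_X_pow (p q : ℕ) :
    skewFormPoly (Polynomial.X ^ p) (Polynomial.X ^ q) =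
      (if p + 1 = q then (q ! : ℂ) / 2 ^ q else 0) -
        (if p = q + 1 then (p ! : ℂ) / 2 ^ p else 0) := by
  have hi : ∀ a b : ℕ, Integrable (fun u : ℂ => u ^ a * conj u ^ b * (gaussianWeight u : ℂ))
      areaMeasure := fun a b => rapidWeight_gaussianWeight.integrable_mul
    (G := fun u => u ^ a * conj u ^ b)
    ((continuous_id.pow a).mul (Complex.continuous_conj.pow b))
    ((PolyGrowth.id.pow a).mul (PolyGrowth.id.star.pow b))
  have e : ∀ u : ℂ, (u ^ p * conj u ^ q - conj u ^ p * u ^ q) * (u - conj u) *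
      (gaussianWeight u : ℂ) =
      (u ^ (p + 1) * conj u ^ q * (gaussianWeight u : ℂ) +
        u ^ q * conj u ^ (p + 1) * (gaussianWeight u : ℂ)) -
      (u ^ p * conj u ^ (q + 1) * (gaussianWeight u : ℂ) +
        u ^ (q + 1) * conj u ^ p * (gaussianWeight u : ℂ)) := fun u => by ring
  rw [skewFormPoly_apply]
  unfold skewForm
  simp only [Polynomial.eval_pow, Polynomial.eval_X, e]
  have ha : ∀ a b c d : ℕ, Integrable (fun u : ℂ => u ^ a * conj u ^ b * (gaussianWeight u : ℂ) +
      u ^ c * conj u ^ d * (gaussianWeight u : ℂ)) areaMeasure :=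
    fun a b c d => (hi a b).add (hi c d)
  rw [integral_sub (ha _ _ _ _) (ha _ _ _ _), integral_add (hi _ _) (hi _ _),
    integral_add (hi _ _) (hi _ _)]
  simp only [integral_pow_mul_conj_pow, eq_comm (a := q) (b := p + 1),
    eq_comm (a := q + 1) (b := p)]
  congr 1
  · split_ifs with h
    · subst h; field_simp; ring
    · simp
  · split_ifs with h
    · subst h; field_simp; ring
    · simp

/-! ### The skew kernel is reproducing -/

/-- The polynomial `y ↦ skewKernel N x y`. -/
def skewKernelPoly (N : ℕ) (x : ℂ) : Polynomial ℂ :=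
  (Real.sqrt 2 : ℂ) • ∑ k ∈ Finset.range N, ∑ l ∈ Finset.range (k + 1),
    ((((Real.sqrt 2 : ℂ) * x) ^ (2 * k + 1) / ((2 * k + 1)‼ : ℂ) *
        ((Real.sqrt 2 : ℂ) ^ (2 * l) / ((2 * l)‼ : ℂ))) • Polynomial.X ^ (2 * l) -
      ((Real.sqrt 2 : ℂ) ^ (2 * k + 1) / ((2 * k + 1)‼ : ℂ) *
        (((Real.sqrt 2 : ℂ) * x) ^ (2 * l) / ((2 * l)‼ : ℂ))) • Polynomial.X ^ (2 * k + 1))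

lemma eval_skewKernelPoly (N : ℕ) (x y : ℂ) :
    (skewKernelPoly N x).eval y = skewKernel N x y := by
  unfold skewKernelPoly skewKernel
  simp only [Polynomial.eval_smul, Polynomial.eval_finsetSum, Polynomial.eval_sub, smul_eq_mul,
    Polynomial.eval_pow, Polynomial.eval_X]
  congr 1
  refine Finset.sum_congr rfl fun k _ => Finset.sum_congr rfl fun l _ => ?_
  simp only [mul_pow]
  ring

lemma degree_skewKernelPoly_lt (N : ℕ) (x : ℂ) :
    (skewKernelPoly N x).degree < (2 * N : ℕ) := by
  rw [← Polynomial.mem_degreeLT]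
  have hX : ∀ i, i < 2 * N → (Polynomial.X : Polynomial ℂ) ^ i ∈ Polynomial.degreeLT ℂ (2 * N) :=
    fun i hi => by
      rw [Polynomial.mem_degreeLT, Polynomial.degree_X_pow]
      exact_mod_cast hi
  refine Submodule.smul_mem _ _ (Submodule.sum_mem _ fun k hk => Submodule.sum_mem _ fun l hl => ?_)
  rw [Finset.mem_range] at hk hl
  exact Submodule.sub_mem _ (Submodule.smul_mem _ _ (hX _ (by omega)))
    (Submodule.smul_mem _ _ (hX _ (by omega)))

lemma skewKernel_antisymm (N : ℕ) (x y : ℂ) : skewKernel N x y = -skewKernel N y x := by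
  unfold skewKernel
  simp only [← mul_neg, ← Finset.sum_neg_distrib, neg_sub]

lemma sqrt_two_sq : (Real.sqrt 2 : ℂ) ^ 2 = 2 := by
  rw [← Complex.ofReal_pow, Real.sq_sqrt zero_le_two, Complex.ofReal_ofNat]

lemma doubleFactorial_ne_zero (n : ℕ) : ((n ‼ : ℕ) : ℂ) ≠ 0 := by
  exact_mod_cast (Nat.doubleFactorial_pos n).ne'

/-- Only even powers of the kernel pair with an odd monomial. The terms l = m and l = m + 1
contribute opposite amounts, so the sum over l ≤ k vanishes unless k = m. -/
lemma skewFormPoly_skewKernelPoly_odd {N m : ℕ} (hm : m < N) (x : ℂ) :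
    skewFormPoly (skewKernelPoly N x) (Polynomial.X ^ (2 * m + 1)) = x ^ (2 * m + 1) := by
  have hd := doubleFactorial_ne_zero
  have hs := sqrt_two_sq
  set s : ℂ := (Real.sqrt 2 : ℂ) with hsdef
  have hin : ∀ k, ∑ l ∈ Finset.range (k + 1), (s ^ (2 * l) / ((2 * l)‼ : ℂ)) *
      skewFormPoly (Polynomial.X ^ (2 * l)) (Polynomial.X ^ (2 * m + 1)) =
      if k = m then ((2 * m + 1)‼ : ℂ) / 2 ^ (m + 1) else 0 := by
    intro k
    have t : ∀ l, (s ^ (2 * l) / ((2 * l)‼ : ℂ)) *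
        skewFormPoly (Polynomial.X ^ (2 * l)) (Polynomial.X ^ (2 * m + 1)) =
        (if l = m then ((2 * m + 1)‼ : ℂ) / 2 ^ (m + 1) else 0) -
        (if l = m + 1 then ((2 * m + 1)‼ : ℂ) / 2 ^ (m + 1) else 0) := by
      intro l
      rw [skewFormPoly_X_pow, pow_mul, hs]
      rcases eq_or_ne l m with rfl | h1
      · have := hd (2 * l)
        rw [if_pos rfl, if_neg (by omega), if_pos rfl, if_neg (by omega),
          Nat.factorial_eq_mul_doubleFactorial]
        push_cast
        field_simp
        ring
      · rcases eq_or_ne l (m + 1) with rfl | h2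
        · have := hd (2 * m + 2)
          rw [if_neg (by omega), if_pos (by omega), if_neg (by omega), if_pos rfl]
          rw [show 2 * (m + 1) = 2 * m + 1 + 1 by ring, Nat.factorial_eq_mul_doubleFactorial]
          push_cast
          field_simp
          ring
        · rw [if_neg (by omega), if_neg (by omega), if_neg h1, if_neg h2]
          simp
    simp only [t, Finset.sum_sub_distrib, Finset.sum_ite_eq', Finset.mem_range]
    split_ifs <;> first | omega | simp
  have hout : ∀ k l, skewFormPoly (Polynomial.X ^ (2 * k + 1) : Polynomial ℂ)
      (Polynomial.X ^ (2 * l + 1)) = 0 := fun k l => by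
    rw [skewFormPoly_X_pow, if_neg (by omega), if_neg (by omega), sub_zero]
  unfold skewKernelPoly
  simp only [map_smul, map_sum, map_sub, LinearMap.smul_apply, LinearMap.sum_apply,
    LinearMap.sub_apply, hout, smul_eq_mul, mul_zero, sub_zero, ← hsdef]
  simp only [mul_assoc, ← Finset.mul_sum, hin]
  simp only [mul_ite, mul_zero, Finset.sum_ite_eq', Finset.mem_range, hm, if_true]
  have := hd (2 * m + 1)
  have hp : s ^ (2 * m + 1) * s = 2 ^ (m + 1) := by
    rw [← pow_succ, show 2 * m + 1 + 1 = 2 * (m + 1) by ring, pow_mul, hs]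
  rw [mul_pow]
  field_simp
  linear_combination x ^ (2 * m + 1) * hp

/-- Only k = m and k = m - 1 contribute, with opposite signs. The difference of the inner partial
sums S m - S (m - 1) is the single term with x^{2m}. -/
lemma skewFormPoly_skewKernelPoly_even {N m : ℕ} (hm : m < N) (x : ℂ) :
    skewFormPoly (skewKernelPoly N x) (Polynomial.X ^ (2 * m)) = x ^ (2 * m) := by
  have hd := doubleFactorial_ne_zero
  have hs := sqrt_two_sq
  set s : ℂ := (Real.sqrt 2 : ℂ) with hsdef
  have ht : ∀ k, (s ^ (2 * k + 1) / ((2 * k + 1)‼ : ℂ)) *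
      skewFormPoly (Polynomial.X ^ (2 * k + 1)) (Polynomial.X ^ (2 * m)) =
      (if k + 1 = m then s * ((2 * m)‼ : ℂ) / 2 ^ (m + 1) else 0) -
        (if k = m then s * ((2 * m)‼ : ℂ) / 2 ^ (m + 1) else 0) := by
    intro k
    rw [skewFormPoly_X_pow, pow_succ, pow_mul, hs]
    have := hd (2 * k + 1)
    rcases eq_or_ne k m with rfl | h1
    · rw [if_neg (by omega), if_pos rfl, if_neg (by omega), if_pos rfl,
        Nat.factorial_eq_mul_doubleFactorial]
      push_cast
      field_simp
      ring
    · rcases eq_or_ne (k + 1) m with rfl | h2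
      · rw [if_pos (by omega), if_neg (by omega), if_pos rfl, if_neg (by omega)]
        rw [show 2 * (k + 1) = 2 * k + 1 + 1 by ring, Nat.factorial_eq_mul_doubleFactorial]
        push_cast
        field_simp
        ring
      · rw [if_neg (by omega), if_neg (by omega), if_neg h2, if_neg h1]
        simp
  have hout : ∀ l, skewFormPoly (Polynomial.X ^ (2 * l) : Polynomial ℂ)
      (Polynomial.X ^ (2 * m)) = 0 := fun l => by
    rw [skewFormPoly_X_pow, if_neg (by omega), if_neg (by omega), sub_zero]
  set S : ℕ → ℂ := fun k => ∑ l ∈ Finset.range (k + 1), (s * x) ^ (2 * l) / ((2 * l)‼ : ℂ) with hS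
  have hsum : skewFormPoly (skewKernelPoly N x) (Polynomial.X ^ (2 * m)) =
      -s * ∑ k ∈ Finset.range N, S k *
        ((if k + 1 = m then s * ((2 * m)‼ : ℂ) / 2 ^ (m + 1) else 0) -
        (if k = m then s * ((2 * m)‼ : ℂ) / 2 ^ (m + 1) else 0)) := by
    unfold skewKernelPoly
    simp only [map_smul, map_sum, map_sub, LinearMap.smul_apply, LinearMap.sum_apply,
      LinearMap.sub_apply, hout, smul_eq_mul, mul_zero, zero_sub, ← hsdef, ← ht]
    simp only [hS, Finset.sum_mul, neg_mul, Finset.mul_sum, Finset.sum_neg_distrib, mul_neg]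
    congr 1
    refine Finset.sum_congr rfl fun k _ => Finset.sum_congr rfl fun l _ => ?_
    ring
  have hB : (s * x) ^ (2 * m) / ((2 * m)‼ : ℂ) * (s * (s * ((2 * m)‼ : ℂ) / 2 ^ (m + 1))) =
      x ^ (2 * m) := by
    have := hd (2 * m)
    rw [mul_pow, pow_mul s, hs]
    field_simp
    linear_combination x ^ (2 * m) * 2 ^ m * hs
  rw [hsum, ← hB]
  simp only [mul_sub, Finset.sum_sub_distrib, mul_ite, mul_zero, Finset.sum_ite_eq',
    Finset.mem_range, hm, if_true]
  -- For m = 0 there is no k = m - 1, and S 0 is already the single required term.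
  cases m with
  | zero => simp [hS]
  | succ m =>
    simp only [Nat.add_right_cancel_iff, Finset.sum_ite_eq', Finset.mem_range,
      show m < N by omega, if_true]
    have hSS : S (m + 1) = S m + (s * x) ^ (2 * (m + 1)) / ((2 * (m + 1))‼ : ℂ) := by
      simp only [hS]; rw [Finset.sum_range_succ]
    rw [hSS]
    ring

lemma skewForm_skewKernel {N : ℕ} {f : Polynomial ℂ} (hf : f.degree < (2 * N : ℕ)) (x : ℂ) :
    skewForm (fun y => skewKernel N x y) (fun y => f.eval y) = f.eval x := by
  have hX : ∀ i, i < 2 * N →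
      skewFormPoly (skewKernelPoly N x) (Polynomial.X ^ i) = x ^ i := fun i hi => by
    rcases Nat.even_or_odd' i with ⟨m, rfl | rfl⟩
    · exact skewFormPoly_skewKernelPoly_even (by omega) x
    · exact skewFormPoly_skewKernelPoly_odd (by omega) x
  have hfs : f = ∑ i ∈ Finset.range (2 * N), f.coeff i • Polynomial.X ^ i := by
    rcases eq_or_ne f 0 with rfl | h0
    · simp
    · conv_lhs => rw [f.as_sum_range' (2 * N) ((Polynomial.natDegree_lt_iff_degree_lt h0).mpr hf)]
      simp only [Polynomial.smul_X_eq_monomial]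
  have key : skewFormPoly (skewKernelPoly N x) f = f.eval x := by
    rw [hfs]
    simp only [map_sum, map_smul, Polynomial.eval_finsetSum, Polynomial.eval_smul,
      Polynomial.eval_pow, Polynomial.eval_X]
    exact Finset.sum_congr rfl fun i hi => by rw [hX i (Finset.mem_range.mp hi)]
  simpa only [skewFormPoly_apply, eval_skewKernelPoly] using key

/-! ### Identification of the averaged kernel with the skew kernel -/

/-- Before averaging, the expression is a polynomial in y of degree at most 2n + 1, hence determined
by its values at 2n + 2 fixed nodes. That interpolation formula is linear, so it survives
integration. -/
lemma exists_polynomial_meanCharPair (n : ℕ) (x : ℂ) :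
    ∃ Q : Polynomial ℂ, Q.degree < (2 * (n + 1) : ℕ) ∧
      ∀ y, Q.eval y = (x - y) * meanCharPair n x y := by
  set v : Fin (2 * (n + 1)) → ℂ := fun i => ((i : ℕ) : ℂ) with hv
  have hvi : Set.InjOn v (Finset.univ : Finset (Fin (2 * (n + 1)))) := fun i _ k _ h => by
    simpa [hv, Fin.ext_iff] using h
  refine ⟨Lagrange.interpolate Finset.univ v fun i => (x - v i) * meanCharPair n x (v i), ?_, ?_⟩
  · simpa using Lagrange.degree_interpolate_lt (s := Finset.univ)
      (fun i => (x - v i) * meanCharPair n x (v i)) hvi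
  intro y
  have hp : ∀ w : Fin n → ℂ, (x - y) * charPair x y w =
      ∑ i, (x - v i) * charPair x (v i) w * (Lagrange.basis Finset.univ v i).eval y := by
    intro w
    set P : Polynomial ℂ := Polynomial.C (∏ l, (x - w l) * (x - conj (w l))) *
      (Polynomial.C x - Polynomial.X) *
      ∏ l, ((Polynomial.X - Polynomial.C (w l)) * (Polynomial.X - Polynomial.C (conj (w l))))
      with hP
    have hev : ∀ t, P.eval t = (x - t) * charPair x t w := fun t => by
      unfold charPair
      simp only [hP, Polynomial.eval_mul, Polynomial.eval_C, Polynomial.eval_sub,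
        Polynomial.eval_X, Polynomial.eval_prod, Finset.prod_mul_distrib]
      ring
    have hdeg : P.degree < (Finset.univ : Finset (Fin (2 * (n + 1)))).card := by
      refine lt_of_le_of_lt Polynomial.degree_le_natDegree ?_
      have h1 : (∏ l, ((Polynomial.X - Polynomial.C (w l)) *
          (Polynomial.X - Polynomial.C (conj (w l)))) : Polynomial ℂ).natDegree ≤
          ∑ _l : Fin n, 2 := by
        refine (Polynomial.natDegree_prod_le _ _).trans (Finset.sum_le_sum fun l _ => ?_)
        refine Polynomial.natDegree_mul_le.trans ?_
        simp
      have h2 : (Polynomial.C x - Polynomial.X).natDegree ≤ 1 := by compute_degree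
      have h3 : P.natDegree ≤ 0 + 1 + ∑ _l : Fin n, 2 := by
        refine Polynomial.natDegree_mul_le.trans (add_le_add (Polynomial.natDegree_mul_le.trans
          (add_le_add (Polynomial.natDegree_C _).le h2)) h1)
      have h4 : P.natDegree < 2 * (n + 1) := by
        simp at h3; omega
      rw [Finset.card_univ, Fintype.card_fin]
      exact_mod_cast h4
    have h := congrArg (Polynomial.eval y) (Lagrange.eq_interpolate hvi hdeg)
    rw [Lagrange.interpolate_apply, Polynomial.eval_finsetSum] at h
    simpa only [Polynomial.eval_mul, Polynomial.eval_C, hev] using h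
  have hint : (x - y) * meanCharPair n x y =
      ∑ i, (x - v i) * (Lagrange.basis Finset.univ v i).eval y * meanCharPair n x (v i) := by
    unfold meanCharPair
    simp only [← integral_const_mul]
    rw [← integral_finsetSum _ fun i _ => (integrable_charPair _ _).const_mul _]
    congr 1
    ext w
    rw [← mul_assoc, hp, Finset.sum_mul]
    exact Finset.sum_congr rfl fun i _ => by ring
  rw [hint, Lagrange.interpolate_apply, Polynomial.eval_finsetSum]
  refine Finset.sum_congr rfl fun i _ => ?_
  rw [Polynomial.eval_mul, Polynomial.eval_C]
  ring

/-- Pair the averaged kernel at x with ϰ_N(y, ·). Each reproducing property evaluates this pairing,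
and antisymmetry of the form and of ϰ_N matches the signs. -/
theorem partitionFunction_mul_skewKernel (n : ℕ) (x y : ℂ) :
    partitionFunction gaussianWeight (n + 1) * skewKernel (n + 1) x y =
      ((n : ℂ) + 1) * ((x - y) * meanCharPair n x y) := by
  obtain ⟨Q, hQd, hQ⟩ := exists_polynomial_meanCharPair n x
  have h1 := skewForm_skewKernel hQd y
  have h2 := skewForm_meanCharPair n (degree_skewKernelPoly_lt (n + 1) y) x
  simp only [hQ] at h1
  simp only [eval_skewKernelPoly] at h2
  rw [← h1, skewForm_antisymm, mul_neg, h2, skewKernel_antisymm (n + 1) x y]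
  ring

/-! ### The one-point function and the mean diagonal overlap -/

/-- The factor `|u - a|² |u - conj a|²` by which a point at `a` changes the weight at `u`. -/
def insertionFactor (p : ℂ × ℂ) : ℝ := ‖p.1 - p.2‖ ^ 2 * ‖p.1 - conj p.2‖ ^ 2

/-- The non-Gaussian factor of the overlap weight. -/
def overlapFactor (p : ℂ × ℂ) : ℝ := ‖p.2 - conj p.1‖ ^ 2 * (1 + ‖p.2 - p.1‖ ^ 2)

/-- The partition function of the weight conditioned on a point at `a`. -/
def insertionPartition (n : ℕ) (a : ℂ) : ℝ :=
  partitionFunction (fun u => insertionFactor (a, u) * gaussianWeight u) n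

lemma continuous_conj_comp {E : Type*} [TopologicalSpace E] {f : E → ℂ} (hf : Continuous f) :
    Continuous fun e => conj (f e) := Complex.continuous_conj.comp hf

lemma continuous_insertionFactor : Continuous insertionFactor :=
  .mul (.pow (.norm (.sub continuous_fst continuous_snd)) _)
    (.pow (.norm (.sub continuous_fst (continuous_conj_comp continuous_snd))) _)

lemma polyGrowth_insertionFactor : PolyGrowth insertionFactor :=
  .mul (.pow (.norm (.sub .fst .snd)) _) (.pow (.norm (.sub .fst PolyGrowth.snd.star)) _)

lemma continuous_overlapFactor : Continuous overlapFactor :=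
  .mul (.pow (.norm (.sub continuous_snd (continuous_conj_comp continuous_fst))) _)
    (.add continuous_const (.pow (.norm (.sub continuous_snd continuous_fst)) _))

lemma polyGrowth_overlapFactor : PolyGrowth overlapFactor :=
  .mul (.pow (.norm (.sub .snd PolyGrowth.fst.star)) _)
    (.add (.const _) (.pow (.norm (.sub .snd .fst)) _))

lemma polyGrowth_prodMk (a : ℂ) : PolyGrowth fun u : ℂ => (a, u) :=
  (((PolyGrowth.const (E := ℂ) a).norm).add (PolyGrowth.id (E := ℂ)).norm).of_norm_le fun u => by
    rw [Prod.norm_def, Real.norm_of_nonneg (by positivity)]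
    exact max_le (by linarith [norm_nonneg u]) (by linarith [norm_nonneg a])

lemma ne_of_norm_lt {a u : ℂ} (h : ‖a‖ < ‖u‖) : a - u ≠ 0 := fun h' => by
  rw [sub_eq_zero.mp h'] at h
  exact lt_irrefl _ h

lemma insertionPartition_pos (n : ℕ) (a : ℂ) : 0 < insertionPartition n a :=
  partitionFunction_pos (q := fun u => insertionFactor (a, u))
    (continuous_insertionFactor.comp (Continuous.prodMk_right a))
    (polyGrowth_insertionFactor.comp (polyGrowth_prodMk a))
    (fun u => by simp only [insertionFactor]; positivity) ‖a‖ (fun u hu => by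
      have h1 := norm_pos_iff.mpr (ne_of_norm_lt hu)
      have h2 := norm_pos_iff.mpr (ne_of_norm_lt (a := a) (u := conj u) (by simpa using hu))
      simp only [insertionFactor]
      positivity) n

lemma partitionFunction_overlapWeight_pos (n : ℕ) (a : ℂ) :
    0 < partitionFunction (overlapWeight a) n :=
  partitionFunction_pos (q := fun u => overlapFactor (a, u))
    (continuous_overlapFactor.comp (Continuous.prodMk_right a))
    (polyGrowth_overlapFactor.comp (polyGrowth_prodMk a))
    (fun u => by simp only [overlapFactor]; positivity) ‖a‖ (fun u hu => by
      have h := norm_pos_iff.mpr (ne_of_norm_lt (a := conj a) (u := u) (by simpa using hu))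
      rw [norm_sub_rev] at h
      simp only [overlapFactor]
      positivity) n

lemma partitionFunction_gaussianWeight_pos (n : ℕ) : 0 < partitionFunction gaussianWeight n := by
  simpa using partitionFunction_pos (q := fun _ => 1) continuous_const (.const _)
    (fun _ => zero_le_one) 0 (fun _ _ => one_pos) n

lemma continuous_insertionPartition (n : ℕ) : Continuous (insertionPartition n) :=
  continuous_partitionFunction continuous_insertionFactor polyGrowth_insertionFactor n

lemma continuous_partitionFunction_overlapWeight (n : ℕ) :
    Continuous fun a => partitionFunction (overlapWeight a) n :=
  continuous_partitionFunction continuous_overlapFactor polyGrowth_overlapFactor n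

/-- At y = ā the four linear factors combine into |a - w|²|a - w̄|². -/
lemma meanCharPair_conj (n : ℕ) (a : ℂ) :
    meanCharPair n a (conj a) = insertionPartition n a := by
  unfold meanCharPair insertionPartition partitionFunction
  rw [← integral_complex_ofReal]
  congr 1
  ext w
  rw [symplecticWeight_mul, Complex.ofReal_mul, Complex.ofReal_prod]
  congr 1
  unfold charPair insertionFactor
  refine Finset.prod_congr rfl fun l _ => ?_
  rw [Complex.ofReal_mul, ofReal_norm_sq, ofReal_norm_sq, map_sub, map_sub, Complex.conj_conj]
  ring

lemma joinConfig_one {n : ℕ} (a : ℂ) (w : Fin n → ℂ) :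
    joinConfig (N := n + 1) (k := 1) (fun _ => a) w = Fin.cons a w := by
  ext j
  refine Fin.cases ?_ (fun i => ?_) j
  · simp [joinConfig]
  · simp [joinConfig]

lemma factorial_div_factorial (n : ℕ) :
    ((n + 1)! : ℝ) / ((n + 1 - 1)! : ℝ) = n + 1 := by
  rw [Nat.add_sub_cancel, Nat.factorial_succ]
  have : ((n ! : ℕ) : ℝ) ≠ 0 := by exact_mod_cast n.factorial_ne_zero
  push_cast
  field_simp

lemma correlation_one (n : ℕ) (a : ℂ) :
    correlation gaussianWeight (n + 1) 1 (fun _ => a) =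
      (n + 1) / partitionFunction gaussianWeight (n + 1) * (‖a - conj a‖ ^ 2 * gaussianWeight a) *
        insertionPartition n a := by
  unfold correlation
  rw [factorial_div_factorial]
  change _ * ∫ w : Fin n → ℂ, jointDensity gaussianWeight
    (joinConfig (N := n + 1) (k := 1) (fun _ => a) w) ∂(areaMeasurePi n) = _
  have e : ∀ w : Fin n → ℂ, jointDensity gaussianWeight
      (joinConfig (N := n + 1) (k := 1) (fun _ => a) w) =
      (1 / partitionFunction gaussianWeight (n + 1) * (‖a - conj a‖ ^ 2 * gaussianWeight a)) *
        symplecticWeight (fun u => insertionFactor (a, u) * gaussianWeight u) w := fun w => by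
    unfold jointDensity
    rw [joinConfig_one, symplecticWeight_cons, symplecticWeight_mul]
    unfold insertionFactor
    ring
  simp only [e]
  rw [integral_const_mul]
  unfold insertionPartition partitionFunction
  ring

lemma meanDiagonalOverlap_one (n : ℕ) (a : ℂ) :
    meanDiagonalOverlap (n + 1) 1 (fun _ => a) =
      (n + 1) / partitionFunction gaussianWeight (n + 1) * (‖a - conj a‖ ^ 2 * gaussianWeight a) *
        partitionFunction (overlapWeight a) n := by
  unfold meanDiagonalOverlap
  rw [factorial_div_factorial]
  change _ * ∫ w : Fin n → ℂ,
      (∏ j ∈ Finset.univ.filter (fun j : Fin (n + 1) => 0 < (j : ℕ)), ∏ l ∈ Finset.Ioi j,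
          ‖joinConfig (N := n + 1) (k := 1) (fun _ => a) w j -
              joinConfig (N := n + 1) (k := 1) (fun _ => a) w l‖ ^ 2 *
            ‖joinConfig (N := n + 1) (k := 1) (fun _ => a) w j -
              conj (joinConfig (N := n + 1) (k := 1) (fun _ => a) w l)‖ ^ 2) *
        ∏ l ∈ Finset.univ.filter (fun l : Fin (n + 1) => 0 < (l : ℕ)),
          ‖joinConfig (N := n + 1) (k := 1) (fun _ => a) w l -
              conj (joinConfig (N := n + 1) (k := 1) (fun _ => a) w l)‖ ^ 2 *
            overlapWeight a (joinConfig (N := n + 1) (k := 1) (fun _ => a) w l)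
      ∂(areaMeasurePi n) = _
  -- Indices with positive value are exactly the successors, so the restricted products run over the
  -- n integrated points.
  have e : ∀ r : Fin (n + 1) → ℝ,
      ∏ j ∈ Finset.univ.filter (fun j : Fin (n + 1) => 0 < (j : ℕ)), r j =
        ∏ j : Fin n, r j.succ := fun r => by
    rw [Finset.prod_filter, Fin.prod_univ_succ]
    simp
  simp only [joinConfig_one, e, Fin.prod_Ioi_succ, Fin.cons_succ]
  unfold partitionFunction symplecticWeight gaussianWeight
  ring

lemma norm_sub_conj_pos {a : ℂ} (ha : a.im ≠ 0) : 0 < ‖a - conj a‖ := by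
  refine norm_pos_iff.mpr fun h => ha ?_
  have := congrArg Complex.im h
  rw [Complex.sub_im, Complex.conj_im, Complex.zero_im] at this
  linarith

lemma overlapQuotient_eq (n : ℕ) {a : ℂ} (ha : a.im ≠ 0) :
    overlapQuotient (n + 1) a =
      partitionFunction (overlapWeight a) n / insertionPartition n a := by
  unfold overlapQuotient
  rw [meanDiagonalOverlap_one, correlation_one]
  have h1 := norm_sub_conj_pos ha
  have h2 := partitionFunction_gaussianWeight_pos (n + 1)
  have h3 := gaussianWeight_pos a
  exact mul_div_mul_left _ _ (by positivity)

instance neBot_nhdsWithin_im_ne_zero (a : ℝ) : (𝓝[{z : ℂ | z.im ≠ 0}] (a : ℂ)).NeBot := by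
  refine mem_closure_iff_nhdsWithin_neBot.mp ?_
  have ht : Tendsto (fun t : ℝ => (a : ℂ) + t * Complex.I) (𝓝[≠] 0) (𝓝 (a : ℂ)) := by
    have hc : Continuous fun t : ℝ => (a : ℂ) + t * Complex.I := by fun_prop
    simpa using (hc.tendsto 0).mono_left nhdsWithin_le_nhds
  refine mem_closure_of_tendsto ht ?_
  filter_upwards [self_mem_nhdsWithin] with t ht'
  simpa using ht'

lemma tendsto_overlapQuotient (n : ℕ) (a : ℝ) :
    Tendsto (overlapQuotient (n + 1)) (𝓝[{z : ℂ | z.im ≠ 0}] (a : ℂ))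
      (𝓝 (partitionFunction (overlapWeight (a : ℂ)) n / insertionPartition n (a : ℂ))) := by
  have hc : ContinuousAt (fun z : ℂ =>
      partitionFunction (overlapWeight z) n / insertionPartition n z) (a : ℂ) :=
    (continuous_partitionFunction_overlapWeight n).continuousAt.div
      (continuous_insertionPartition n).continuousAt (insertionPartition_pos n _).ne'
  refine (hc.tendsto.mono_left nhdsWithin_le_nhds).congr' ?_
  filter_upwards [self_mem_nhdsWithin] with z hz
  exact (overlapQuotient_eq n hz).symm

lemma conditionalOverlap_eq (n : ℕ) (a : ℂ) :
    conditionalOverlap (n + 1) a =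
      partitionFunction (overlapWeight a) n / insertionPartition n a := by
  unfold conditionalOverlap
  split_ifs with h
  · exact overlapQuotient_eq n h
  · obtain ⟨r, rfl⟩ : ∃ r : ℝ, a = r := ⟨a.re, Complex.ext rfl (by simpa using h)⟩
    exact (tendsto_overlapQuotient n r).limUnder_eq

lemma skewKernel_succ (n : ℕ) (x y : ℂ) :
    skewKernel (n + 1) x y = ((n : ℂ) + 1) / partitionFunction gaussianWeight (n + 1) *
      ((x - y) * meanCharPair n x y) := by
  have h : ((partitionFunction gaussianWeight (n + 1) : ℝ) : ℂ) ≠ 0 := by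
    exact_mod_cast (partitionFunction_gaussianWeight_pos (n + 1)).ne'
  rw [div_mul_eq_mul_div, ← partitionFunction_mul_skewKernel]
  field_simp

/-- For a function (x - a) h(x) the difference quotient at a is h(x) itself, so continuity of h
gives the derivative h(a). -/
lemma deriv_skewKernelHat (n : ℕ) (a : ℝ) :
    deriv (fun x : ℂ => skewKernelHat (n + 1) x (a : ℂ)) (a : ℂ) =
      Real.exp (-2 * a ^ 2) * (((n : ℂ) + 1) / partitionFunction gaussianWeight (n + 1) *
        insertionPartition n (a : ℂ)) := by
  have hF : meanCharPair n (a : ℂ) (a : ℂ) = insertionPartition n (a : ℂ) := by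
    rw [← meanCharPair_conj, Complex.conj_ofReal]
  set h : ℂ → ℂ := fun x => Complex.exp (-2 * x * a) *
    (((n : ℂ) + 1) / partitionFunction gaussianWeight (n + 1) * meanCharPair n x a) with hh
  have hc : Continuous h := by
    have hm : Continuous fun x : ℂ => meanCharPair n x a := by
      have := (continuous_meanCharPair n).comp (Continuous.prodMk_left (a : ℂ))
      simpa only [Function.comp_def] using this
    exact .mul (by fun_prop) (continuous_const.mul hm)
  have he : (fun x : ℂ => skewKernelHat (n + 1) x (a : ℂ)) = fun x => (x - a) * h x := by
    ext x
    unfold skewKernelHat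
    rw [skewKernel_succ]
    simp only [hh]
    ring
  have hd : HasDerivAt (fun x : ℂ => (x - a) * h x) (h a) (a : ℂ) := by
    rw [hasDerivAt_iff_tendsto_slope]
    refine (hc.continuousAt.tendsto.mono_left nhdsWithin_le_nhds).congr' ?_
    filter_upwards [self_mem_nhdsWithin] with x hx
    have : x - (a : ℂ) ≠ 0 := sub_ne_zero.mpr hx
    simp only [slope_def_field, sub_self, zero_mul, sub_zero]
    field_simp
  rw [he, hd.deriv]
  simp only [hh, hF]
  congr 1
  push_cast
  congr 1
  ring

end GinSE

end

/-! ### The conditional overlap formula -/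

theorem proposition2p5 (N : ℕ) (hN : 1 ≤ N) :
    0 < partitionFunction gaussianWeight N ∧
    (∀ a : ℂ, 0 < partitionFunction (overlapWeight a) (N - 1)) ∧
    (∀ a : ℂ, a.im ≠ 0 →
      0 < correlation gaussianWeight N 1 (fun _ => a) ∧
      skewKernel N a (conj a) ≠ 0 ∧
      (conditionalOverlap N a : ℂ) =
        (N : ℂ) * (partitionFunction (overlapWeight a) (N - 1) : ℂ) /
            (partitionFunction gaussianWeight N : ℂ) *
          ((a - conj a) / skewKernel N a (conj a))) ∧
    (∀ a : ℝ,
      Tendsto (overlapQuotient N) (𝓝[{z : ℂ | z.im ≠ 0}] (a : ℂ))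
        (𝓝 (conditionalOverlap N (a : ℂ))) ∧
      deriv (fun x : ℂ => skewKernelHat N x (a : ℂ)) (a : ℂ) ≠ 0 ∧
      (conditionalOverlap N (a : ℂ) : ℂ) =
        (N : ℂ) * (partitionFunction (overlapWeight (a : ℂ)) (N - 1) : ℂ) /
            (partitionFunction gaussianWeight N : ℂ) *
          ((Real.exp (-2 * a ^ 2) : ℂ) /
            deriv (fun x : ℂ => skewKernelHat N x (a : ℂ)) (a : ℂ))) := by
  obtain ⟨n, rfl⟩ : ∃ n, N = n + 1 := ⟨N - 1, by omega⟩
  have hZ := partitionFunction_gaussianWeight_pos (n + 1)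
  have hZ' : (partitionFunction gaussianWeight (n + 1) : ℂ) ≠ 0 := by exact_mod_cast hZ.ne'
  have hn : ((n : ℂ) + 1) ≠ 0 := by exact_mod_cast n.succ_ne_zero
  have hY : ∀ a, (insertionPartition n a : ℂ) ≠ 0 := fun a => by
    exact_mod_cast (insertionPartition_pos n a).ne'
  simp only [Nat.add_sub_cancel, conditionalOverlap_eq]
  refine ⟨hZ, partitionFunction_overlapWeight_pos n, fun a ha => ?_, fun a => ?_⟩
  · have hpos := norm_sub_conj_pos ha
    have hne : a - conj a ≠ 0 := norm_pos_iff.mp hpos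
    have hYa := hY a
    rw [skewKernel_succ, meanCharPair_conj]
    refine ⟨?_, by positivity, ?_⟩
    · rw [correlation_one]
      have := gaussianWeight_pos a
      have := insertionPartition_pos n a
      positivity
    · push_cast
      field_simp
  · have hYa := hY a
    have he : ((Real.exp (-2 * a ^ 2) : ℝ) : ℂ) ≠ 0 := by exact_mod_cast (Real.exp_pos _).ne'
    rw [deriv_skewKernelHat]
    refine ⟨tendsto_overlapQuotient n a, ?_, ?_⟩
    · exact mul_ne_zero he (mul_ne_zero (div_ne_zero hn hZ') hYa)
    -- Made opaque so that `push_cast` does not rewrite the exponential, whose nonvanishing `he` is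
    -- needed for the cancellation.
    · generalize ((Real.exp (-2 * a ^ 2) : ℝ) : ℂ) = t at he ⊢
      push_cast
      field_simp
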